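/- **Setting.** A market $I$ consists of finitely many sellers; seller $i$ owns one divisible item of utility $u_i\ge 0$ and cost $c_i\ge 0$, and at least one $u_i$ is positive. Put $\gamma_i=c_i/u_i$ (sellers of utility $0$ play no role). For a budget $B>0$ let $\mathrm{OPT}(I,B)=\max\{\sum_i u_ix_i : x\in[0,1]^n,\ \sum_i c_ix_i\le B\}$. For a set $S$ of sellers let $U_p(S)=\sum_{i\in S,\ \gamma_i\le p}u_i$. For a non-increasing allocation rule $f$, Myerson's payment per unit of utility is $Q_f(\gamma)=\gamma f(\gamma)+\int_\gamma^\infty f(z)\,dz$. **Greedy** (on a set $S$ of sellers with budget $B$) computes an allocation rule $f$. Initially $p=0$, $f(0)=1$, and $f=0$ elsewhere. As long as $S$ contains sellers with $\gamma_i>p$, it chooses among the values $g=\gamma_i>p$, $i\in S$, one that maximizes $(U_g(S)-U_p(S))/q(p,g)$, where $q(p,g)=(g-p)U_p(S)+g\,(U_g(S)-U_p(S))$. If $B>q(p,g)$, it sets $f=1$ on $(p,g]$, replaces $B$ by $B-q(p,g)$ and $p$ by $g$, and continues; otherwise it sets $f=B/q(p,g)$ on $(p,g]$ and stops. Then $f$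 is $1$ on $[0,p_1]$, $t$ on $(p_1,p_2]$ and $0$ beyond $p_2$, for some $t\in[0,1)$ and $0\le p_1\le p_2$, with $p_1$ the last value up to which $f$ was set to $1$. On the market $I$, Greedy (with $S$ the set of all sellers) buys the fraction $f(\gamma_i)$ of each item. **Random-Sampling-Greedy** with parameters $\varepsilon_1,\delta_1\in(0,1)$, $\eta>0$ and an integer $C\ge 1$: let $T$ be a set of $C$ sellers of highest utilities (all sellers if there are fewer than $C$), and let $U(T)$ be their total utility. Each seller of $T$ is offered $\varepsilon_1B/C$ for her item and accepts if and only if this is at least her cost. The remaining sellers are partitioned uniformly at random into $X$ and $Y$. Let $f_X,f_Y$ be the rules that Greedy computes for $X$ and for $Y$ with budget $(1-\delta_1)B/2$, and let $\hat f_X,\hat f_Y$ be their truncations: a rule with parameters $(t,p_1,p_2)$ is lowered to the value $t$ on $[0,p_1]$ if the sellers outside $T$ with $\gamma_i\le p_1$ have total utility less than $U(T)/(\eta C)$, and is unchanged otherwise. Then $\hat f_X$ with its Myerson payments is applied to the sellers of $Y$ one after the other, until the next payment would make the expenditure on $Y$ exceed $(1-\varepsilon_1)B/2$; likewise $\hat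 f_Y$ is applied to $X$. For a mechanism $\mathcal M$, let $\mathcal R_{\mathcal M}(I,B)$ be its expected utility divided by $\mathrm{OPT}(I,B)$. For a probability distribution $\mathcal D$ of budgets, its $\mathcal D$-budget-smoothed competitive ratio over a class of markets is $\inf_I \mathbb E_{B\sim\mathcal D}[\mathcal R_{\mathcal M}(I,B)]$, the infimum being over the markets $I$ of the class. **Theorem.** Let $\mathcal D$ be a Borel probability distribution of budgets, concentrated on $(0,\infty)$, whose support has at least two points. 1. For every way of breaking ties in Greedy, the $\mathcal D$-budget-smoothed competitive ratio of Greedy over all markets is strictly greater than $1-1/e$. 2. There are parameters $\varepsilon_1,\delta_1,\eta,C$ and a number $\theta>0$ such that, for all choices left open in the description (ties in Greedy, the set $T$, the order in which sellers are served), the $\mathcal D$-budget-smoothed competitive ratio of Random-Sampling-Greedy over the markets with $\theta$-small bidders is strictly greater than $1-1/e$. Here $I$ has $\theta$-small bidders if $\Pr_{B\sim\mathcal D}[\max_i c_i>\theta B]\le\theta$. -/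

import Mathlib

open MeasureTheory
open scoped ENNReal

namespace BudgetFeasible

noncomputable section

/-- A market of `n` sellers; seller `i` owns one divisible item of utility `u i` and cost `c i`.
At least one utility is positive, so that the optimum is nonzero for every positive budget. -/
structure Market where
  n : ℕ
  u : Fin n → ℝ
  c : Fin n → ℝ
  u_nonneg : ∀ i, 0 ≤ u i
  c_nonneg : ∀ i, 0 ≤ c i
  exists_u_pos : ∃ i, 0 < u i

namespace Market

/-- Cost per utility. A seller of utility `0` gets the value `0`; she adds zero to every
utility and to every payment below. -/
def gamma (I : Market) (i : Fin I.n) : ℝ := I.c i / I.u i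

/-- The non-IC optimum: the optimal value of the (fractional) knapsack problem with budget `B`. -/
def opt (I : Market) (B : ℝ) : ℝ :=
  sSup {v : ℝ | ∃ x : Fin I.n → ℝ, (∀ i, 0 ≤ x i ∧ x i ≤ 1) ∧
    ∑ i, I.c i * x i ≤ B ∧ v = ∑ i, I.u i * x i}

/-- `U_p(S)`: total utility of the sellers in `S` whose cost per utility is at most `p`. -/
def utilUpTo (I : Market) (S : Finset (Fin I.n)) (p : ℝ) : ℝ :=
  ∑ i ∈ S with I.gamma i ≤ p, I.u i

/-- The values `γ_i < γ_{i+1} < ⋯` of the merged sellers of `S` that exceed `p = γ_{i-1}`. -/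
def candidates (I : Market) (S : Finset (Fin I.n)) (p : ℝ) : Finset ℝ :=
  (S.image I.gamma).filter (fun g => p < g)

/-- The payment needed to raise the allocation from `0` to `1` on `(p, g]` when it is `1` on
`[0, p]`. -/
def qMax (I : Market) (S : Finset (Fin I.n)) (p g : ℝ) : ℝ :=
  (g - p) * I.utilUpTo S p + g * (I.utilUpTo S g - I.utilUpTo S p)

/-- Marginal utility per marginal payment of raising the allocation on `(p, g]`. -/
def efficiency (I : Market) (S : Finset (Fin I.n)) (p g : ℝ) : ℝ :=
  (I.utilUpTo S g - I.utilUpTo S p) / I.qMax S p g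

/-- The candidates of maximal efficiency. -/
def bestCandidates (I : Market) (S : Finset (Fin I.n)) (p : ℝ) : Finset ℝ :=
  (I.candidates S p).filter
    (fun g => ∀ g' ∈ I.candidates S p, I.efficiency S p g' ≤ I.efficiency S p g)

lemma bestCandidates_nonempty (I : Market) (S : Finset (Fin I.n)) (p : ℝ)
    (h : (I.candidates S p).Nonempty) : (I.bestCandidates S p).Nonempty := by
  obtain ⟨g, hg, hmax⟩ := Finset.exists_max_image _ (I.efficiency S p) h
  exact ⟨g, Finset.mem_filter.2 ⟨hg, hmax⟩⟩

lemma card_candidates_lt (I : Market) (S : Finset (Fin I.n)) (p g : ℝ)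
    (hg : g ∈ I.candidates S p) : (I.candidates S g).card < (I.candidates S p).card := by
  apply Finset.card_lt_card
  rw [Finset.ssubset_iff_of_subset]
  · exact ⟨g, hg, by simp [candidates]⟩
  · intro x hx
    simp only [candidates, Finset.mem_filter] at hx hg ⊢
    exact ⟨hx.1, hg.2.trans hx.2⟩

end Market

/-- The choices that the descriptions of the mechanisms leave open: how ties are broken when the
most efficient candidate is selected, which sellers form the set of the `C` sellers of highest
utilities, and the order in which the sellers of a set are served. -/
structure Choices where
  pick : Finset ℝ → ℝ
  pick_mem : ∀ s : Finset ℝ, s.Nonempty → pick s ∈ s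
  top : (I : Market) → ℕ → Finset (Fin I.n)
  top_card : ∀ I C, (top I C).card = min C I.n
  top_spec : ∀ I C, ∀ i ∈ top I C, ∀ j ∉ top I C, I.u j ≤ I.u i
  order : (I : Market) → Finset (Fin I.n) → List (Fin I.n)
  order_nodup : ∀ I S, (order I S).Nodup
  mem_order : ∀ I S i, i ∈ order I S ↔ i ∈ S

/-- A monotone allocation rule with at most two steps: the value is `1` up to `p₁`,
`t` on `(p₁, p₂]`, and `0` beyond `p₂`. -/
structure Rule where
  t : ℝ
  p₁ : ℝ
  p₂ : ℝ

namespace Rule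

/-- The allocation function. -/
def alloc (f : Rule) (γ : ℝ) : ℝ :=
  if γ ≤ f.p₁ then 1 else if γ ≤ f.p₂ then f.t else 0

/-- Myerson's payment per utility. -/
def pay (f : Rule) (γ : ℝ) : ℝ := γ * f.alloc γ + ∫ z in Set.Ioi γ, f.alloc z

end Rule

/-- The loop of Greedy on the sellers in `S`: the allocation is already `1` on `[0, p]`, and `B` is
the remaining budget. The result is written with `t < 1`, so the case `B = qMax`, in which the
allocation becomes `1` on `(p, g]` and the loop stops, is listed separately. -/
def greedyLoop (K : Choices) (I : Market) (S : Finset (Fin I.n)) (p B : ℝ) : Rule :=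
  if h : (I.candidates S p).Nonempty then
    if I.qMax S p (K.pick (I.bestCandidates S p)) < B then
      greedyLoop K I S (K.pick (I.bestCandidates S p))
        (B - I.qMax S p (K.pick (I.bestCandidates S p)))
    else if B = I.qMax S p (K.pick (I.bestCandidates S p)) then
      ⟨0, K.pick (I.bestCandidates S p), K.pick (I.bestCandidates S p)⟩
    else
      ⟨B / I.qMax S p (K.pick (I.bestCandidates S p)), p, K.pick (I.bestCandidates S p)⟩
  else ⟨0, p, p⟩
termination_by (I.candidates S p).card
decreasing_by
  exact I.card_candidates_lt S p _ (Finset.mem_of_mem_filter _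
    (K.pick_mem _ (I.bestCandidates_nonempty S p h)))

/-- The allocation rule that Greedy computes for the sellers in `S` and the budget `B`. -/
def greedyRule (K : Choices) (I : Market) (S : Finset (Fin I.n)) (B : ℝ) : Rule :=
  greedyLoop K I S 0 B

/-- The utility that Greedy obtains on the whole market. -/
def greedyUtility (K : Choices) (I : Market) (B : ℝ) : ℝ :=
  ∑ i, I.u i * (greedyRule K I Finset.univ B).alloc (I.gamma i)

/-- The competitive ratio of Greedy on the instance `(I, B)`. -/
def greedyRatio (K : Choices) (I : Market) (B : ℝ) : ℝ := greedyUtility K I B / I.opt B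

/-- The parameters of Random-Sampling-Greedy. -/
structure RSGParams where
  ε₁ : ℝ
  δ₁ : ℝ
  η : ℝ
  C : ℕ
  ε₁_pos : 0 < ε₁
  ε₁_lt_one : ε₁ < 1
  δ₁_pos : 0 < δ₁
  δ₁_lt_one : δ₁ < 1
  η_pos : 0 < η
  C_pos : 0 < C

/-- Truncation: `p₁` is replaced by a negative number (no seller has a negative cost per utility)
if the sellers outside `T` with cost per utility at most `p₁` have total utility less than
`U(T) / (η C)`. -/
def truncate (P : RSGParams) (I : Market) (T : Finset (Fin I.n)) (f : Rule) : Rule :=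
  if I.utilUpTo (Finset.univ \ T) f.p₁ < (∑ i ∈ T, I.u i) / (P.η * P.C)
  then ⟨f.t, -1, f.p₂⟩ else f

/-- The utility obtained when the rule `f` with its Myerson payments is applied to the listed
sellers one after the other, where `spent` was spent before; the process stops at the first seller
whose payment would make the total expenditure exceed `limit`. -/
def buySeq (I : Market) (f : Rule) (limit : ℝ) : ℝ → List (Fin I.n) → ℝ
  | _, [] => 0
  | spent, i :: l =>
      if spent + I.u i * f.pay (I.gamma i) ≤ limit then
        I.u i * f.alloc (I.gamma i) + buySeq I f limit (spent + I.u i * f.pay (I.gamma i)) l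
      else 0

/-- The utility obtained from the sellers in `Y` with the truncated Greedy rule of `X`. -/
def crossUtility (K : Choices) (P : RSGParams) (I : Market) (B : ℝ) (X Y : Finset (Fin I.n)) : ℝ :=
  buySeq I (truncate P I (K.top I P.C) (greedyRule K I X ((1 - P.δ₁) * B / 2)))
    ((1 - P.ε₁) * B / 2) 0 (K.order I Y)

/-- The expected utility of Random-Sampling-Greedy: each of the `C` sellers of highest utilities is
offered `ε₁ B / C` for her item, and accepts if this covers her cost; the other sellers are
partitioned into `X` and `Y` uniformly at random, and the truncated Greedy rule of each part is
applied to the other part. -/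
def rsgUtility (K : Choices) (P : RSGParams) (I : Market) (B : ℝ) : ℝ :=
  (∑ i ∈ K.top I P.C with I.c i ≤ P.ε₁ * B / P.C, I.u i) +
    (∑ X ∈ (Finset.univ \ K.top I P.C).powerset,
        (crossUtility K P I B X ((Finset.univ \ K.top I P.C) \ X) +
          crossUtility K P I B ((Finset.univ \ K.top I P.C) \ X) X)) /
      2 ^ (Finset.univ \ K.top I P.C).card

/-- The competitive ratio of Random-Sampling-Greedy on the instance `(I, B)`. -/
def rsgRatio (K : Choices) (P : RSGParams) (I : Market) (B : ℝ) : ℝ := rsgUtility K P I B / I.opt B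

/-- The budget-smoothed competitive ratio over the markets in `𝓘`: the infimum of the expectation,
over a budget `B` drawn from `D`, of the (nonnegative) competitive ratio `R I B`. -/
def smoothedRatio (D : Measure ℝ) (R : Market → ℝ → ℝ) (𝓘 : Set Market) : ℝ≥0∞ :=
  ⨅ I ∈ 𝓘, ∫⁻ B, ENNReal.ofReal (R I B) ∂D

/-- The markets with `θ`-small bidders: except with probability at most `θ` over the budget `B`,
the cost of every seller is at most `θ B`. -/
def smallBidderMarkets (D : Measure ℝ) (θ : ℝ) : Set Market :=
  {I | D {B : ℝ | ∃ i, θ * B < I.c i} ≤ ENNReal.ofReal θ}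

end

end BudgetFeasible

namespace BudgetFeasible

noncomputable section

namespace Market

variable (I : Market) {S : Finset (Fin I.n)} {p g z B : ℝ}

lemma gamma_nonneg (i : Fin I.n) : 0 ≤ I.gamma i := div_nonneg (I.c_nonneg i) (I.u_nonneg i)

lemma utilUpTo_nonneg (S : Finset (Fin I.n)) (p : ℝ) : 0 ≤ I.utilUpTo S p :=
  Finset.sum_nonneg fun i _ => I.u_nonneg i

lemma utilUpTo_mono (S : Finset (Fin I.n)) : Monotone (I.utilUpTo S) := fun _ _ hpq =>
  Finset.sum_le_sum_of_subset_of_nonneg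
    (Finset.monotone_filter_right S fun _ _ h => h.trans hpq) fun i _ _ => I.u_nonneg i

lemma utilUpTo_le_of_subset {S T : Finset (Fin I.n)} (h : S ⊆ T) (p : ℝ) :
    I.utilUpTo S p ≤ I.utilUpTo T p :=
  Finset.sum_le_sum_of_subset_of_nonneg (Finset.filter_subset_filter _ h) fun i _ _ => I.u_nonneg i

lemma utilUpTo_eq_sum_ite (S : Finset (Fin I.n)) (p : ℝ) :
    I.utilUpTo S p = ∑ i ∈ S, if I.gamma i ≤ p then I.u i else 0 :=
  Finset.sum_filter _ _

lemma mul_utilUpTo_mono (S : Finset (Fin I.n)) (hp : 0 ≤ p) (h : p ≤ g) :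
    p * I.utilUpTo S p ≤ g * I.utilUpTo S g :=
  mul_le_mul h (I.utilUpTo_mono S h) (I.utilUpTo_nonneg S p) (hp.trans h)

lemma qMax_eq (S : Finset (Fin I.n)) (p g : ℝ) :
    I.qMax S p g = g * I.utilUpTo S g - p * I.utilUpTo S p := by
  unfold qMax; ring

lemma utilUpTo_lt_of_mem_candidates (hp : 0 ≤ p) (hg : g ∈ I.candidates S p) :
    I.utilUpTo S p < I.utilUpTo S g := by
  obtain ⟨h, hpg⟩ := Finset.mem_filter.1 hg
  obtain ⟨i, hi, rfl⟩ := Finset.mem_image.1 h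
  have hu : 0 < I.u i := by
    refine (I.u_nonneg i).lt_of_ne fun h0 => ?_
    have : I.gamma i = 0 := by simp [gamma, ← h0]
    linarith
  refine Finset.sum_lt_sum_of_subset (i := i)
    (Finset.monotone_filter_right S fun _ _ h => h.trans hpg.le) ?_ ?_ hu fun j _ _ => I.u_nonneg j
  · simpa using hi
  · simp [hpg]

lemma qMax_pos (hp : 0 ≤ p) (hg : g ∈ I.candidates S p) : 0 < I.qMax S p g := by
  have h := I.utilUpTo_lt_of_mem_candidates hp hg
  have hpg : p < g := (Finset.mem_filter.1 hg).2
  unfold qMax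
  have := I.utilUpTo_nonneg S p
  have h1 : 0 < g * (I.utilUpTo S g - I.utilUpTo S p) := mul_pos (by linarith) (by linarith)
  have h2 : 0 ≤ (g - p) * I.utilUpTo S p := mul_nonneg (by linarith) this
  linarith

lemma efficiency_mul_qMax (hp : 0 ≤ p) (hg : g ∈ I.candidates S p) :
    I.efficiency S p g * I.qMax S p g = I.utilUpTo S g - I.utilUpTo S p :=
  div_mul_cancel₀ _ (I.qMax_pos hp hg).ne'

lemma efficiency_nonneg (hp : 0 ≤ p) (hg : g ∈ I.candidates S p) : 0 ≤ I.efficiency S p g :=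
  div_nonneg (by linarith [I.utilUpTo_lt_of_mem_candidates hp hg]) (I.qMax_pos hp hg).le

lemma exists_candidate_of_utilUpTo_ne (hpz : p ≤ z) (h : I.utilUpTo S z ≠ I.utilUpTo S p) :
    ∃ g ∈ I.candidates S p, g ≤ z ∧ I.utilUpTo S g = I.utilUpTo S z := by
  have hne : ((I.candidates S p).filter (· ≤ z)).Nonempty := by
    by_contra hemp
    rw [Finset.not_nonempty_iff_eq_empty, Finset.filter_eq_empty_iff] at hemp
    refine h (Finset.sum_congr (Finset.filter_congr fun i hi => ⟨fun hz => ?_, fun hi => hi.trans hpz⟩)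
      fun _ _ => rfl)
    by_contra hip
    exact hemp (Finset.mem_filter.2 ⟨Finset.mem_image_of_mem _ hi, not_le.1 hip⟩) hz
  obtain ⟨hg, hgz⟩ := Finset.mem_filter.1 (Finset.max'_mem _ hne)
  refine ⟨_, hg, hgz, Finset.sum_congr (Finset.filter_congr fun i hi =>
    ⟨fun h => h.trans hgz, fun hz => ?_⟩) fun _ _ => rfl⟩
  by_cases hip : I.gamma i ≤ p
  · exact hip.trans (Finset.mem_filter.1 hg).2.le
  · exact Finset.le_max' _ _ (Finset.mem_filter.2
      ⟨Finset.mem_filter.2 ⟨Finset.mem_image_of_mem _ hi, not_le.1 hip⟩, hz⟩)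

/-- The most efficient candidate bounds the slope towards every higher price. -/
lemma utilUpTo_sub_le_efficiency_mul (hp : 0 ≤ p) (hg : g ∈ I.bestCandidates S p) (hpz : p ≤ z) :
    I.utilUpTo S z - I.utilUpTo S p ≤
      I.efficiency S p g * (z * I.utilUpTo S z - p * I.utilUpTo S p) := by
  obtain ⟨hgc, hmax⟩ := Finset.mem_filter.1 hg
  have he := I.efficiency_nonneg hp hgc
  by_cases h : I.utilUpTo S z = I.utilUpTo S p
  · rw [h, sub_self]
    exact mul_nonneg he (by nlinarith [I.utilUpTo_nonneg S p])
  · obtain ⟨g', hg', hgz, hU⟩ := I.exists_candidate_of_utilUpTo_ne hpz h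
    have h1 := I.efficiency_mul_qMax hp hg'
    have h2 := mul_le_mul_of_nonneg_right (hmax g' hg') (I.qMax_pos hp hg').le
    rw [h1, hU, qMax_eq, hU] at h2
    refine h2.trans (mul_le_mul_of_nonneg_left ?_ he)
    have := mul_le_mul_of_nonneg_right hgz (I.utilUpTo_nonneg S z)
    linarith

lemma utilUpTo_le_of_candidates_eq_empty (h : ¬ (I.candidates S p).Nonempty) (z : ℝ) :
    I.utilUpTo S z ≤ I.utilUpTo S p := by
  rcases le_total z p with hz | hz
  · exact I.utilUpTo_mono S hz
  · by_contra hlt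
    obtain ⟨g, hg, -⟩ := I.exists_candidate_of_utilUpTo_ne hz (fun he => hlt he.le)
    exact h ⟨g, hg⟩

/-- The utility of the rule `f` on the sellers in `S`. -/
def ruleUtil (I : Market) (S : Finset (Fin I.n)) (f : Rule) : ℝ :=
  (1 - f.t) * I.utilUpTo S f.p₁ + f.t * I.utilUpTo S f.p₂

/-- The total Myerson payment of the rule `f` to the sellers in `S`. -/
def rulePay (I : Market) (S : Finset (Fin I.n)) (f : Rule) : ℝ :=
  (1 - f.t) * (f.p₁ * I.utilUpTo S f.p₁) + f.t * (f.p₂ * I.utilUpTo S f.p₂)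

/-- The rule `f` is feasible for the budget `B`, and `lam` is a Lagrange multiplier that certifies
its optimality among the mixtures of posted prices. -/
structure IsCertified (I : Market) (S : Finset (Fin I.n)) (B : ℝ) (f : Rule) (lam : ℝ) : Prop where
  t_nonneg : 0 ≤ f.t
  t_le_one : f.t ≤ 1
  p₁_nonneg : 0 ≤ f.p₁
  p₁_le_p₂ : f.p₁ ≤ f.p₂
  pay_le : I.rulePay S f ≤ B
  lam_nonneg : 0 ≤ lam
  le_of_nonneg : ∀ z, 0 ≤ z →
    I.utilUpTo S z - lam * (z * I.utilUpTo S z) ≤ I.ruleUtil S f - lam * B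

end Market

open Market

theorem exists_isCertified_greedyLoop (K : Choices) (I : Market) (S : Finset (Fin I.n)) (p B : ℝ)
    (hp : 0 ≤ p) (hB : 0 < B)
    (hinv : ∀ z, 0 ≤ z → z ≤ p → ∀ g ∈ I.bestCandidates S p,
      I.efficiency S p g * (p * I.utilUpTo S p - z * I.utilUpTo S z) ≤
        I.utilUpTo S p - I.utilUpTo S z) :
    ∃ lam, I.IsCertified S (p * I.utilUpTo S p + B) (greedyLoop K I S p B) lam := by
  rw [greedyLoop]
  by_cases h : (I.candidates S p).Nonempty
  · rw [dif_pos h]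
    have hg := K.pick_mem _ (I.bestCandidates_nonempty S p h)
    set g := K.pick (I.bestCandidates S p)
    have hgc := (Finset.mem_filter.1 hg).1
    have hpg : p < g := (Finset.mem_filter.1 hgc).2
    have hq := I.qMax_pos hp hgc
    have he := I.efficiency_nonneg hp hgc
    have heq := I.efficiency_mul_qMax hp hgc
    have hqe := I.qMax_eq S p g
    have hall : ∀ z, 0 ≤ z → I.utilUpTo S z - I.utilUpTo S p ≤
        I.efficiency S p g * (z * I.utilUpTo S z - p * I.utilUpTo S p) := by
      intro z hz
      rcases le_total p z with hpz | hzp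
      · exact I.utilUpTo_sub_le_efficiency_mul hp hg hpz
      · have := hinv z hz hzp g hg
        linarith
    split_ifs with h1 h2
    · have hinv' : ∀ z, 0 ≤ z → z ≤ g → ∀ g' ∈ I.bestCandidates S g,
          I.efficiency S g g' * (g * I.utilUpTo S g - z * I.utilUpTo S z) ≤
            I.utilUpTo S g - I.utilUpTo S z := by
        intro z hz hzg g' hg'
        have hgc' := (Finset.mem_filter.1 hg').1
        have hg0 : 0 ≤ g := hp.trans hpg.le
        have hq' := I.qMax_pos hg0 hgc'
        have hle : I.efficiency S g g' ≤ I.efficiency S p g := by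
          have e1 := hall g' (hg0.trans (Finset.mem_filter.1 hgc').2.le)
          have e2 := I.efficiency_mul_qMax hg0 hgc'
          rw [qMax_eq] at e2 hq'
          refine le_of_mul_le_mul_right ?_ hq'
          rw [hqe] at heq
          linarith
        have e3 := mul_le_mul_of_nonneg_right hle
          (sub_nonneg.2 (I.mul_utilUpTo_mono S hz hzg))
        have e4 := hall z hz
        rw [hqe] at heq
        linarith
      obtain ⟨lam, hl⟩ := exists_isCertified_greedyLoop K I S g (B - I.qMax S p g)
        (hp.trans hpg.le) (by linarith) hinv'
      refine ⟨lam, ?_⟩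
      convert hl using 1
      rw [hqe]; ring
    · refine ⟨I.efficiency S p g, le_rfl, zero_le_one, hp.trans hpg.le, le_rfl, ?_, he, ?_⟩
      · simp only [rulePay]; rw [h2, hqe]; linarith
      · intro z hz
        have := hall z hz
        simp only [ruleUtil]
        rw [h2, hqe]
        rw [hqe] at heq
        linarith
    · have hlt : B < I.qMax S p g := lt_of_le_of_ne (not_lt.1 h1) h2
      refine ⟨I.efficiency S p g, div_nonneg hB.le hq.le, (div_le_one hq).2 hlt.le, hp, hpg.le,
        ?_, he, ?_⟩
      · have : B / I.qMax S p g * (g * I.utilUpTo S g - p * I.utilUpTo S p) = B := by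
          rw [← hqe, div_mul_cancel₀ _ hq.ne']
        simp only [rulePay]
        linarith
      · intro z hz
        have := hall z hz
        have e : B / I.qMax S p g * (I.utilUpTo S g - I.utilUpTo S p) =
            I.efficiency S p g * B := by
          rw [efficiency]; ring
        simp only [ruleUtil]
        linarith
  · rw [dif_neg h]
    refine ⟨0, le_rfl, zero_le_one, hp, le_rfl, ?_, le_rfl, fun z _ => ?_⟩
    · simp only [rulePay]; linarith
    · have := I.utilUpTo_le_of_candidates_eq_empty h z
      simp only [ruleUtil]; linarith
termination_by (I.candidates S p).card
decreasing_by
  exact I.card_candidates_lt S p _ (Finset.mem_of_mem_filter _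
    (K.pick_mem _ (I.bestCandidates_nonempty S p h)))

theorem exists_isCertified_greedyRule (K : Choices) (I : Market) (S : Finset (Fin I.n)) {B : ℝ}
    (hB : 0 < B) : ∃ lam, I.IsCertified S B (greedyRule K I S B) lam := by
  have := exists_isCertified_greedyLoop K I S 0 B le_rfl hB (fun z hz hz' g _ => by
    obtain rfl := le_antisymm hz' hz
    simp)
  simpa [greedyRule] using this

lemma sum_mul_alloc (I : Market) (S : Finset (Fin I.n)) {f : Rule} (h : f.p₁ ≤ f.p₂) :
    ∑ i ∈ S, I.u i * f.alloc (I.gamma i) = I.ruleUtil S f := by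
  simp only [ruleUtil, utilUpTo_eq_sum_ite, Finset.mul_sum, ← Finset.sum_add_distrib]
  refine Finset.sum_congr rfl fun i _ => ?_
  unfold Rule.alloc
  split_ifs <;> first | (exfalso; linarith) | ring

lemma greedyUtility_eq (K : Choices) (I : Market) {B : ℝ} (hB : 0 < B) :
    greedyUtility K I B = I.ruleUtil Finset.univ (greedyRule K I Finset.univ B) := by
  obtain ⟨lam, h⟩ := exists_isCertified_greedyRule K I Finset.univ hB
  exact sum_mul_alloc I _ h.p₁_le_p₂

open Real (negMulLog)

lemma negMulLog_lt_exp_neg_one {x : ℝ} (hx : 0 ≤ x) (hne : x ≠ Real.exp (-1)) :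
    negMulLog x < Real.exp (-1) := by
  rcases hx.eq_or_lt with rfl | hx
  · simpa using Real.exp_pos _
  · have h1 : -Real.log x - 1 ≠ 0 := fun h => hne (by
      rw [← Real.exp_log hx]; congr 1; linarith)
    have h2 := Real.add_one_lt_exp h1
    have h3 : Real.exp (-Real.log x - 1) = x⁻¹ * Real.exp (-1) := by
      rw [sub_eq_add_neg, Real.exp_add, Real.exp_neg, Real.exp_log hx]
    rw [h3, sub_add_cancel, inv_mul_eq_div, lt_div_iff₀ hx] at h2
    rw [negMulLog]; linarith

lemma negMulLog_le_exp_neg_one {x : ℝ} (hx : 0 ≤ x) : negMulLog x ≤ Real.exp (-1) := by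
  by_cases h : x = Real.exp (-1)
  · rw [h, negMulLog, Real.log_exp]; linarith
  · exact (negMulLog_lt_exp_neg_one hx h).le

lemma exp_neg_one_lt_half : Real.exp (-1) < 1 / 2 := by
  have := Real.exp_one_gt_d9
  rw [Real.exp_neg, inv_eq_one_div]
  exact one_div_lt_one_div_of_lt (by norm_num) (by linarith)

/-- Data certifying the value of Greedy for the supply curve `U` and the budget `B` against the
value `O`: `a + lam * B` is the value of Greedy. -/
structure Certificate (U : ℝ → ℝ) (a lam O B : ℝ) : Prop where
  a_pos : 0 < a
  lam_pos : 0 < lam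
  a_le : a ≤ O
  supply_le : ∀ z, 0 ≤ z → U z - lam * (z * U z) ≤ a
  value_le : ∀ Z, 0 ≤ Z → O * Z - ∫ z in (0:ℝ)..Z, U z ≤ B

namespace Certificate

variable {U : ℝ → ℝ} {a lam O B Z : ℝ}

lemma O_pos (h : Certificate U a lam O B) : 0 < O := h.a_pos.trans_le h.a_le

lemma one_sub_pos (h : Certificate U a lam O B) (hZ : lam * Z ≤ 1 - a / O) {z : ℝ} (hz : z ≤ Z) :
    0 < 1 - lam * z := by
  have h1 := mul_le_mul_of_nonneg_left hz h.lam_pos.le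
  have h2 := div_pos h.a_pos h.O_pos
  linarith

lemma supply_le_div (h : Certificate U a lam O B) (hZ : lam * Z ≤ 1 - a / O) {z : ℝ} (h0 : 0 ≤ z)
    (hz : z ≤ Z) : U z ≤ a / (1 - lam * z) := by
  rw [le_div_iff₀ (h.one_sub_pos hZ hz)]
  have := h.supply_le z h0
  linarith

lemma intervalIntegrable_div (h : Certificate U a lam O B) (hZ : lam * Z ≤ 1 - a / O)
    (h0 : 0 ≤ Z) : IntervalIntegrable (fun z => a / (1 - lam * z)) volume 0 Z := by
  apply ContinuousOn.intervalIntegrable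
  rw [Set.uIcc_of_le h0]
  exact ContinuousOn.div (by fun_prop) (by fun_prop) fun z hz => (h.one_sub_pos hZ hz.2).ne'

lemma integral_gap_le (h : Certificate U a lam O B) (hU : Monotone U) :
    ∫ z in (0:ℝ)..((1 - a / O) / lam), (a / (1 - lam * z) - U z) ≤
      (a + lam * B - O + O * negMulLog (a / O)) / lam := by
  have hO := h.O_pos
  have hl := h.lam_pos
  have ha := h.a_pos
  set Z := (1 - a / O) / lam with hZdef
  have hZ : lam * Z = 1 - a / O := by rw [hZdef]; field_simp
  have hZ0 : 0 ≤ Z := div_nonneg (by rw [sub_nonneg, div_le_one hO]; exact h.a_le) hl.le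
  have hpos : 0 < a / O := div_pos ha hO
  rw [intervalIntegral.integral_sub (h.intervalIntegrable_div hZ.le hZ0) hU.intervalIntegrable]
  have hint : ∫ z in (0:ℝ)..Z, a / (1 - lam * z) = O * negMulLog (a / O) / lam := by
    simp_rw [div_eq_mul_inv a]
    rw [intervalIntegral.integral_const_mul,
      intervalIntegral.integral_comp_sub_mul (fun x => x⁻¹) hl.ne' 1, hZ, mul_zero, sub_zero,
      sub_sub_cancel, integral_inv_of_pos hpos one_pos, negMulLog, one_div, Real.log_inv,
      smul_eq_mul]
    field_simp
  have hv := h.value_le Z hZ0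
  have hOZ : O * Z = (O - a) / lam := by rw [hZdef]; field_simp
  rw [hint]
  rw [hOZ] at hv
  have e : (a + lam * B - O + O * negMulLog (a / O)) / lam =
      O * negMulLog (a / O) / lam + (B - (O - a) / lam) := by field_simp; ring
  rw [e]
  linarith

lemma integral_gap_mono (h : Certificate U a lam O B) (hU : Monotone U) (h0 : 0 ≤ Z)
    (hZ : lam * Z ≤ 1 - a / O) :
    ∫ z in (0:ℝ)..Z, (a / (1 - lam * z) - U z) ≤
      ∫ z in (0:ℝ)..((1 - a / O) / lam), (a / (1 - lam * z) - U z) := by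
  have hl := h.lam_pos
  have hZ' : lam * ((1 - a / O) / lam) ≤ 1 - a / O := by rw [mul_div_cancel₀ _ hl.ne']
  have hle : Z ≤ (1 - a / O) / lam := by rw [le_div_iff₀ hl]; linarith
  apply intervalIntegral.integral_mono_interval le_rfl h0 hle
  · refine (ae_restrict_iff' measurableSet_Ioc).2 (Filter.Eventually.of_forall fun z hz => ?_)
    exact sub_nonneg.2 (h.supply_le_div hZ' hz.1.le hz.2)
  · exact (h.intervalIntegrable_div hZ' (h0.trans hle)).sub hU.intervalIntegrable

lemma one_sub_negMulLog_mul_le (h : Certificate U a lam O B) (hU : Monotone U) :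
    (1 - negMulLog (a / O)) * O ≤ a + lam * B := by
  have h0 : lam * 0 ≤ 1 - a / O := by
    rw [mul_zero, sub_nonneg, div_le_one h.O_pos]; exact h.a_le
  have h1 := (h.integral_gap_mono hU le_rfl h0).trans (h.integral_gap_le hU)
  rw [intervalIntegral.integral_same, le_div_iff₀ h.lam_pos] at h1
  linarith

lemma one_sub_exp_mul_le (h : Certificate U a lam O B) (hU : Monotone U) :
    (1 - Real.exp (-1)) * O ≤ a + lam * B :=
  le_trans (mul_le_mul_of_nonneg_right (sub_le_sub_left
    (negMulLog_le_exp_neg_one (div_pos h.a_pos h.O_pos).le) 1) h.O_pos.le)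
    (h.one_sub_negMulLog_mul_le hU)

/-- Two certificates for the same supply curve: the curves they impose differ by little. -/
lemma sub_le_gap {a' lam' O' B' : ℝ} (h : Certificate U a lam O B)
    (h' : Certificate U a' lam' O' B') (hU : Monotone U) (h0 : 0 ≤ Z)
    (hZ : lam * Z ≤ 1 - a / O) (hZ' : lam' * Z ≤ 1 - a' / O') :
    (a - a') * Z - (a * lam' - a' * lam) * (Z ^ 2 / 2) ≤
      (a + lam * B - O + O * negMulLog (a / O)) / lam := by
  refine le_trans ?_ ((h.integral_gap_mono hU h0 hZ).trans (h.integral_gap_le hU))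
  have e : (a - a') * Z - (a * lam' - a' * lam) * (Z ^ 2 / 2) =
      ∫ z in (0:ℝ)..Z, ((a - a') - (a * lam' - a' * lam) * z) := by
    rw [intervalIntegral.integral_sub (by simp) (by apply Continuous.intervalIntegrable; fun_prop),
      intervalIntegral.integral_const_mul]
    simp
    ring
  rw [e]
  refine intervalIntegral.integral_mono_on h0 (by apply Continuous.intervalIntegrable; fun_prop)
    ((h.intervalIntegrable_div hZ h0).sub hU.intervalIntegrable) fun z hz => ?_
  have p1 := h.one_sub_pos hZ hz.2
  have p2 := h'.one_sub_pos hZ' hz.2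
  have q1 := h.supply_le z hz.1
  have q2 := h'.supply_le z hz.1
  have r1 := h.supply_le_div hZ hz.1 hz.2
  have r2 : (1 - lam * z) * (1 - lam' * z) ≤ 1 := by
    have := mul_nonneg h.lam_pos.le hz.1
    have := mul_nonneg h'.lam_pos.le hz.1
    nlinarith
  have r3 : (a / (1 - lam * z)) * (1 - lam * z) = a := div_mul_cancel₀ _ p1.ne'
  have r4 := mul_le_mul_of_nonneg_left r2 (sub_nonneg.2 r1)
  have r5 : (a / (1 - lam * z) - U z) * ((1 - lam * z) * (1 - lam' * z)) =
      (a - U z * (1 - lam * z)) * (1 - lam' * z) := by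
    rw [← mul_assoc, sub_mul, r3]
  have r6 : 0 ≤ (a' - U z * (1 - lam' * z)) * (1 - lam * z) :=
    mul_nonneg (by linarith) p1.le
  nlinarith

end Certificate

/-- The violation of the equations that two tight budgets would satisfy. -/
def tightGap (x : (ℝ × ℝ) × (ℝ × ℝ) × (ℝ × ℝ)) : ℝ :=
  (Real.exp (-1) - negMulLog x.1.1) + (Real.exp (-1) - negMulLog x.1.2) +
  |x.2.1.1 + x.1.1 - (1 - Real.exp (-1))| + |x.2.1.2 + x.1.2 - (1 - Real.exp (-1))| +
  |x.2.1.1 * x.2.1.2 * ((x.1.1 - x.1.2 * x.2.2.1) -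
    (x.1.1 * (x.2.1.2 * x.2.2.1 * x.2.2.2) - x.1.2 * x.2.2.1 * x.2.1.1) / 2)| +
  |x.2.1.1 * x.2.1.2 * ((x.1.1 - x.1.2 * x.2.2.1) / 2 -
    (x.1.1 * (x.2.1.2 * x.2.2.1 * x.2.2.2) - x.1.2 * x.2.2.1 * x.2.1.1) / 8)|

lemma exists_pos_le_tightGap {ρ R : ℝ} (hρ : 1 < ρ) (hR : 1 ≤ R) :
    ∃ c > 0, ∀ α₁ ∈ Set.Icc (0:ℝ) 1, ∀ α₂ ∈ Set.Icc (0:ℝ) 1, ∀ l₁ ∈ Set.Icc (0:ℝ) 1,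
      ∀ l₂ ∈ Set.Icc (0:ℝ) 1, ∀ r ∈ Set.Icc 1 R, ∀ b ∈ Set.Icc 0 ρ⁻¹,
      c ≤ tightGap ((α₁, α₂), (l₁, l₂), (r, b)) := by
  let K : Set ((ℝ × ℝ) × (ℝ × ℝ) × (ℝ × ℝ)) :=
    (Set.Icc 0 1 ×ˢ Set.Icc 0 1) ×ˢ ((Set.Icc 0 1 ×ˢ Set.Icc 0 1) ×ˢ (Set.Icc 1 R ×ˢ Set.Icc 0 ρ⁻¹))
  have hK : IsCompact K := (isCompact_Icc.prod isCompact_Icc).prod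
    ((isCompact_Icc.prod isCompact_Icc).prod (isCompact_Icc.prod isCompact_Icc))
  have hne : K.Nonempty := ⟨((0, 0), (0, 0), (1, 0)), by simp [K, hR]; positivity⟩
  have hcont : Continuous tightGap := by unfold tightGap; fun_prop
  obtain ⟨⟨⟨α₁, α₂⟩, ⟨l₁, l₂⟩, ⟨r, b⟩⟩, hx, hmin⟩ := hK.exists_isMinOn hne hcont.continuousOn
  refine ⟨tightGap ((α₁, α₂), (l₁, l₂), (r, b)), ?_, fun α₁ h1 α₂ h2 l₁ h3 l₂ h4 r h5 b h6 =>
    hmin (show ((α₁, α₂), (l₁, l₂), (r, b)) ∈ K from ⟨⟨h1, h2⟩, ⟨h3, h4⟩, ⟨h5, h6⟩⟩)⟩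
  obtain ⟨⟨⟨h1, -⟩, ⟨h2, -⟩⟩, -, -, ⟨-, hb⟩⟩ := hx
  simp only at h1 h2 hb
  have hb1 : b < 1 := hb.trans_lt (inv_lt_one_of_one_lt₀ hρ)
  by_contra hle
  simp only [tightGap] at hle
  have n1 := negMulLog_le_exp_neg_one h1
  have n2 := negMulLog_le_exp_neg_one h2
  have he := exp_neg_one_lt_half
  have he0 := Real.exp_pos (-1)
  have p1 := abs_nonneg (l₁ + α₁ - (1 - Real.exp (-1)))
  have p2 := abs_nonneg (l₂ + α₂ - (1 - Real.exp (-1)))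
  have p3 := abs_nonneg (l₁ * l₂ * ((α₁ - α₂ * r) - (α₁ * (l₂ * r * b) - α₂ * r * l₁) / 2))
  have p4 := abs_nonneg (l₁ * l₂ * ((α₁ - α₂ * r) / 2 - (α₁ * (l₂ * r * b) - α₂ * r * l₁) / 8))
  have e1 : α₁ = Real.exp (-1) := by
    by_contra hne
    linarith [negMulLog_lt_exp_neg_one h1 hne]
  have e2 : α₂ = Real.exp (-1) := by
    by_contra hne
    linarith [negMulLog_lt_exp_neg_one h2 hne]
  have q1 := abs_nonpos_iff.1 (show |l₁ + α₁ - (1 - Real.exp (-1))| ≤ 0 by linarith)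
  have q2 := abs_nonpos_iff.1 (show |l₂ + α₂ - (1 - Real.exp (-1))| ≤ 0 by linarith)
  have hl : l₁ * l₂ ≠ 0 := mul_ne_zero (by linarith) (by linarith)
  have q3 := (mul_eq_zero.1 (abs_nonpos_iff.1 (show |l₁ * l₂ * ((α₁ - α₂ * r) -
    (α₁ * (l₂ * r * b) - α₂ * r * l₁) / 2)| ≤ 0 by linarith))).resolve_left hl
  have q4 := (mul_eq_zero.1 (abs_nonpos_iff.1 (show |l₁ * l₂ * ((α₁ - α₂ * r) / 2 -
    (α₁ * (l₂ * r * b) - α₂ * r * l₁) / 8)| ≤ 0 by linarith))).resolve_left hl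
  have hr : r = 1 := by
    have : Real.exp (-1) * (1 - r) = 0 := by rw [e1, e2] at q3 q4; linarith
    rcases mul_eq_zero.1 this with h | h <;> linarith
  have hll : l₁ = l₂ := by linarith
  subst hr hll e1 e2
  have : Real.exp (-1) * l₁ * (1 - b) = 0 := by linarith
  rcases mul_eq_zero.1 this with h | h
  · rcases mul_eq_zero.1 h with h | h <;> linarith
  · linarith

/-- For two budgets whose ratio is bounded away from `1` and from `∞`, the guarantee `1 - 1/e`
cannot be almost tight at both of them. -/
lemma exists_gap_of_two_budgets {ρ R : ℝ} (hρ : 1 < ρ) (hR : 1 ≤ R) :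
    ∃ δ > 0, ∀ (U : ℝ → ℝ) (a₁ lam₁ O₁ B₁ a₂ lam₂ O₂ B₂ : ℝ), Monotone U → 0 < B₁ →
      ρ * B₁ ≤ B₂ → B₂ ≤ R * B₁ → O₁ ≤ O₂ → O₂ * B₁ ≤ O₁ * B₂ →
      Certificate U a₁ lam₁ O₁ B₁ → Certificate U a₂ lam₂ O₂ B₂ →
      a₁ + lam₁ * B₁ ≤ (1 - Real.exp (-1) + δ) * O₁ →
      (1 - Real.exp (-1) + δ) * O₂ < a₂ + lam₂ * B₂ := by
  obtain ⟨c, hc, hgap⟩ := exists_pos_le_tightGap hρ hR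
  have he0 := Real.exp_pos (-1)
  refine ⟨min (Real.exp (-1)) (c / (8 * R)), by positivity, ?_⟩
  set δ := min (Real.exp (-1)) (c / (8 * R)) with hδ
  have hδ0 : 0 < δ := by positivity
  have hδe : δ ≤ Real.exp (-1) := min_le_left _ _
  have hδc : 8 * (R * δ) ≤ c := by
    have : δ ≤ c / (8 * R) := min_le_right _ _
    rw [le_div_iff₀ (by positivity)] at this
    linarith
  intro U a₁ lam₁ O₁ B₁ a₂ lam₂ O₂ B₂ hU hB₁ hρB hRB hO hOB h₁ h₂ hv₁
  by_contra! hv₂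
  have hO₁ := h₁.O_pos
  have hO₂ := h₂.O_pos
  have hB₂ : 0 < B₂ := (mul_pos (by linarith) hB₁).trans_le hρB
  have hlam₁ := h₁.lam_pos
  have hlam₂ := h₂.lam_pos
  have n1 := negMulLog_le_exp_neg_one (div_pos h₁.a_pos hO₁).le
  have n2 := negMulLog_le_exp_neg_one (div_pos h₂.a_pos hO₂).le
  have m1 := h₁.one_sub_negMulLog_mul_le hU
  have m2 := h₂.one_sub_negMulLog_mul_le hU
  have hα₁ := div_pos h₁.a_pos hO₁
  have hα₂ := div_pos h₂.a_pos hO₂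
  have hl₁ : 0 < lam₁ * B₁ / O₁ := by positivity
  have hl₂ : 0 < lam₂ * B₂ / O₂ := by positivity
  have gap1 : (a₁ + lam₁ * B₁ - O₁ + O₁ * negMulLog (a₁ / O₁)) / lam₁ ≤ δ * O₁ / lam₁ := by
    gcongr
    linarith [mul_le_mul_of_nonneg_left n1 hO₁.le]
  have gap2 : (a₂ + lam₂ * B₂ - O₂ + O₂ * negMulLog (a₂ / O₂)) / lam₂ ≤ δ * O₂ / lam₂ := by
    gcongr
    linarith [mul_le_mul_of_nonneg_left n2 hO₂.le]
  set α₁ := a₁ / O₁ with hα₁def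
  set α₂ := a₂ / O₂ with hα₂def
  set l₁ := lam₁ * B₁ / O₁ with hl₁def
  set l₂ := lam₂ * B₂ / O₂ with hl₂def
  have ea₁ : a₁ = α₁ * O₁ := by rw [hα₁def]; field_simp
  have ea₂ : a₂ = α₂ * O₂ := by rw [hα₂def]; field_simp
  have el₁ : lam₁ * B₁ = l₁ * O₁ := by rw [hl₁def]; field_simp
  have el₂ : lam₂ * B₂ = l₂ * O₂ := by rw [hl₂def]; field_simp
  have s1 : α₁ + l₁ ≤ 1 - Real.exp (-1) + δ := by
    refine le_of_mul_le_mul_right ?_ hO₁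
    linarith
  have s2 : α₂ + l₂ ≤ 1 - Real.exp (-1) + δ := by
    refine le_of_mul_le_mul_right ?_ hO₂
    linarith
  have t1 : 1 - negMulLog α₁ ≤ α₁ + l₁ := by
    refine le_of_mul_le_mul_right ?_ hO₁
    linarith
  have t2 : 1 - negMulLog α₂ ≤ α₂ + l₂ := by
    refine le_of_mul_le_mul_right ?_ hO₂
    linarith
  have hl₂' : lam₂ * (B₁ / O₁) ≤ l₂ := by
    rw [hl₂def, mul_div_assoc]
    refine mul_le_mul_of_nonneg_left ?_ hlam₂.le
    rw [div_le_div_iff₀ hO₁ hO₂]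
    linarith
  have key : ∀ Z, 0 ≤ Z → Z ≤ 1 → |l₁ * l₂ * ((α₁ - α₂ * (O₂ / O₁)) * Z -
      (α₁ * (l₂ * (O₂ / O₁) * (B₁ / B₂)) - α₂ * (O₂ / O₁) * l₁) * (Z ^ 2 / 2))| ≤ R * δ := by
    intro Z hZ0 hZ1
    have hs : 0 ≤ Z * (B₁ / O₁) := by positivity
    have hz1 : lam₁ * (Z * (B₁ / O₁)) ≤ 1 - a₁ / O₁ := by
      have : lam₁ * (Z * (B₁ / O₁)) = Z * l₁ := by rw [hl₁def]; ring
      rw [this, ← hα₁def]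
      linarith [mul_le_of_le_one_left hl₁.le hZ1]
    have hz2 : lam₂ * (Z * (B₁ / O₁)) ≤ 1 - a₂ / O₂ := by
      have : lam₂ * (Z * (B₁ / O₁)) = Z * (lam₂ * (B₁ / O₁)) := by ring
      rw [this, ← hα₂def]
      have : 0 ≤ lam₂ * (B₁ / O₁) := by positivity
      linarith [mul_le_of_le_one_left this hZ1]
    have g1 := (h₁.sub_le_gap h₂ hU hs hz1 hz2).trans gap1
    have g2 := (h₂.sub_le_gap h₁ hU hs hz2 hz1).trans gap2
    have hk : 0 ≤ l₁ * l₂ / B₁ := by positivity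
    have g1' := mul_le_mul_of_nonneg_left g1 hk
    have g2' := mul_le_mul_of_nonneg_left g2 hk
    have e0 : l₁ * l₂ * ((α₁ - α₂ * (O₂ / O₁)) * Z -
        (α₁ * (l₂ * (O₂ / O₁) * (B₁ / B₂)) - α₂ * (O₂ / O₁) * l₁) * (Z ^ 2 / 2)) =
        l₁ * l₂ / B₁ * ((a₁ - a₂) * (Z * (B₁ / O₁)) -
          (a₁ * lam₂ - a₂ * lam₁) * ((Z * (B₁ / O₁)) ^ 2 / 2)) := by
      rw [hl₁def, hl₂def, hα₁def, hα₂def]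
      field_simp
    have e1 : l₁ * l₂ / B₁ * (δ * O₁ / lam₁) = δ * l₂ := by
      rw [hl₁def]; field_simp
    have e2 : l₁ * l₂ / B₁ * (δ * O₂ / lam₂) = δ * l₁ * (B₂ / B₁) := by
      rw [hl₂def]; field_simp
    rw [e1, ← e0] at g1'
    rw [e2] at g2'
    have hBB : B₂ / B₁ ≤ R := by rw [div_le_iff₀ hB₁]; exact hRB
    have hRδ : δ ≤ R * δ := le_mul_of_one_le_left hδ0.le hR
    have b1 : δ * l₂ ≤ R * δ := (mul_le_of_le_one_right hδ0.le (by linarith)).trans hRδ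
    have b2 : δ * l₁ * (B₂ / B₁) ≤ R * δ := by
      have : δ * l₁ ≤ δ := mul_le_of_le_one_right hδ0.le (by linarith)
      calc δ * l₁ * (B₂ / B₁) ≤ δ * R := by gcongr
        _ = R * δ := mul_comm _ _
    rw [abs_le]
    refine ⟨?_, g1'.trans b1⟩
    rw [e0]
    linarith
  have k1 := key 1 zero_le_one le_rfl
  have k2 := key (1 / 2) (by norm_num) (by norm_num)
  have hfin := hgap α₁ ⟨hα₁.le, by linarith⟩ α₂ ⟨hα₂.le, by linarith⟩ l₁ ⟨hl₁.le, by linarith⟩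
    l₂ ⟨hl₂.le, by linarith⟩ (O₂ / O₁) ⟨by rwa [le_div_iff₀ hO₁, one_mul], by
      rw [div_le_iff₀ hO₁]
      refine le_of_mul_le_mul_right (hOB.trans ?_) hB₁
      linarith [mul_le_mul_of_nonneg_left hRB hO₁.le]⟩ (B₁ / B₂) ⟨by positivity, by
      rw [div_le_iff₀ hB₂, inv_mul_eq_div, le_div_iff₀ (by linarith)]; linarith⟩
  simp only [tightGap] at hfin
  have k3 : |l₁ + α₁ - (1 - Real.exp (-1))| ≤ δ := by rw [abs_le]; constructor <;> linarith
  have k4 : |l₂ + α₂ - (1 - Real.exp (-1))| ≤ δ := by rw [abs_le]; constructor <;> linarith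
  have hRδ : δ ≤ R * δ := le_mul_of_one_le_left hδ0.le hR
  ring_nf at k1 k2 k3 k4 hfin
  linarith

namespace Market

variable (I : Market) {B B₁ B₂ : ℝ}

/-- The feasible fractional purchases for the budget `B`. -/
def feasible (B : ℝ) : Set (Fin I.n → ℝ) :=
  {x | (∀ i, 0 ≤ x i ∧ x i ≤ 1) ∧ ∑ i, I.c i * x i ≤ B}

lemma isCompact_feasible (B : ℝ) : IsCompact (I.feasible B) := by
  refine (isCompact_univ_pi fun _ : Fin I.n => isCompact_Icc (a := (0:ℝ)) (b := 1)).of_isClosed_subset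
    ?_ fun x hx i _ => hx.1 i
  have h2 : IsClosed {x : Fin I.n → ℝ | ∑ i, I.c i * x i ≤ B} :=
    isClosed_le (by fun_prop) continuous_const
  have h1 : {x : Fin I.n → ℝ | ∀ i, 0 ≤ x i ∧ x i ≤ 1} = Set.pi Set.univ fun _ => Set.Icc 0 1 := by
    ext
    simp only [Set.mem_ofPred_eq, Set.mem_pi, Set.mem_univ, true_imp_iff, Set.mem_Icc]
  exact (h1 ▸ isClosed_set_pi fun _ _ => isClosed_Icc : IsClosed
    {x : Fin I.n → ℝ | ∀ i, 0 ≤ x i ∧ x i ≤ 1}).inter h2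

lemma exists_isGreatest_opt (hB : 0 ≤ B) :
    ∃ x ∈ I.feasible B, I.opt B = ∑ i, I.u i * x i ∧
      ∀ y ∈ I.feasible B, ∑ i, I.u i * y i ≤ I.opt B := by
  obtain ⟨x, hx, hmax⟩ := (I.isCompact_feasible B).exists_isMaxOn
    ⟨0, by simpa [feasible] using hB⟩
    (Continuous.continuousOn (f := fun x : Fin I.n → ℝ => ∑ i, I.u i * x i) (by fun_prop))
  have : I.opt B = ∑ i, I.u i * x i := by
    refine IsGreatest.csSup_eq ⟨⟨x, hx.1, hx.2, rfl⟩, ?_⟩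
    rintro v ⟨y, h1, h2, rfl⟩
    exact hmax ⟨h1, h2⟩
  exact ⟨x, hx, this, fun y hy => this ▸ hmax hy⟩

lemma opt_mono (hB : 0 ≤ B₁) (h : B₁ ≤ B₂) : I.opt B₁ ≤ I.opt B₂ := by
  obtain ⟨x, hx, he, -⟩ := I.exists_isGreatest_opt hB
  obtain ⟨-, -, -, hmax⟩ := I.exists_isGreatest_opt (hB.trans h)
  exact he ▸ hmax x ⟨hx.1, hx.2.trans h⟩

lemma opt_mul_le (hB : 0 < B₁) (h : B₁ ≤ B₂) : I.opt B₂ * B₁ ≤ I.opt B₁ * B₂ := by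
  have hB₂ := hB.trans_le h
  obtain ⟨x, hx, he, -⟩ := I.exists_isGreatest_opt hB₂.le
  obtain ⟨-, -, -, hmax⟩ := I.exists_isGreatest_opt hB.le
  have hq : B₁ / B₂ ≤ 1 := (div_le_one hB₂).2 h
  have hq0 : 0 ≤ B₁ / B₂ := by positivity
  have := hmax (fun i => B₁ / B₂ * x i) ⟨fun i => ⟨mul_nonneg hq0 (hx.1 i).1,
    mul_le_one₀ hq (hx.1 i).1 (hx.1 i).2⟩, by
      simp_rw [mul_left_comm _ (B₁ / B₂), ← Finset.mul_sum]
      calc B₁ / B₂ * ∑ i, I.c i * x i ≤ B₁ / B₂ * B₂ := by gcongr; exact hx.2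
        _ = B₁ := div_mul_cancel₀ _ hB₂.ne'⟩
  simp_rw [mul_left_comm _ (B₁ / B₂), ← Finset.mul_sum, ← he] at this
  rw [div_mul_eq_mul_div, div_le_iff₀ hB₂] at this
  linarith

lemma opt_pos (hB : 0 < B) : 0 < I.opt B := by
  obtain ⟨-, -, -, hmax⟩ := I.exists_isGreatest_opt hB.le
  have hC : 0 ≤ ∑ i, I.c i := Finset.sum_nonneg fun i _ => I.c_nonneg i
  set s := B / (B + ∑ i, I.c i) with hs
  have hs0 : 0 < s := by positivity
  have hs1 : s ≤ 1 := (div_le_one (by positivity)).2 (by linarith)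
  refine lt_of_lt_of_le ?_ (hmax (fun _ => s) ⟨fun _ => ⟨hs0.le, hs1⟩, ?_⟩)
  · obtain ⟨i, hi⟩ := I.exists_u_pos
    exact Finset.sum_pos' (fun j _ => mul_nonneg (I.u_nonneg j) hs0.le)
      ⟨i, Finset.mem_univ _, mul_pos hi hs0⟩
  · rw [← Finset.sum_mul, hs, mul_div_assoc', div_le_iff₀ (by positivity)]
    nlinarith

lemma u_mul_gamma_le (i : Fin I.n) : I.u i * I.gamma i ≤ I.c i := by
  rcases (I.u_nonneg i).eq_or_lt with h | h
  · rw [← h, zero_mul]; exact I.c_nonneg i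
  · rw [gamma, mul_div_cancel₀ _ h.ne']

lemma u_le_utilUpTo_gamma (i : Fin I.n) : I.u i ≤ I.utilUpTo Finset.univ (I.gamma i) :=
  Finset.single_le_sum (f := I.u) (fun j _ => I.u_nonneg j) (by simp)

end Market

lemma mul_sub_le_integral_ite {γ Z x : ℝ} (hγ : 0 ≤ γ) (hZ : 0 ≤ Z) (hx0 : 0 ≤ x) (hx1 : x ≤ 1) :
    x * (Z - γ) ≤ ∫ z in (0:ℝ)..Z, if γ ≤ z then (1:ℝ) else 0 := by
  have hm : Monotone fun z : ℝ => if γ ≤ z then (1:ℝ) else 0 := fun a b hab => by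
    dsimp only
    split_ifs <;> first | (exfalso; linarith) | norm_num
  have h0 : ∀ z, 0 ≤ if γ ≤ z then (1:ℝ) else 0 := fun z => by split_ifs <;> norm_num
  rcases le_total Z γ with h | h
  · exact (mul_nonpos_of_nonneg_of_nonpos hx0 (by linarith)).trans
      (intervalIntegral.integral_nonneg hZ fun z _ => h0 z)
  · rw [← intervalIntegral.integral_add_adjacent_intervals (b := γ) hm.intervalIntegrable
      hm.intervalIntegrable]
    have h1 : ∫ z in γ..Z, (if γ ≤ z then (1:ℝ) else 0) = ∫ z in γ..Z, (1:ℝ) :=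
      intervalIntegral.integral_congr fun z hz => by
        rw [Set.uIcc_of_le h] at hz
        simp [hz.1]
    rw [h1, intervalIntegral.integral_const, smul_eq_mul, mul_one]
    have := intervalIntegral.integral_nonneg (μ := volume) hγ fun z _ => h0 z
    nlinarith

namespace Market

variable (I : Market) {B : ℝ}

lemma opt_mul_sub_integral_le (hB : 0 ≤ B) {Z : ℝ} (hZ : 0 ≤ Z) :
    I.opt B * Z - ∫ z in (0:ℝ)..Z, I.utilUpTo Finset.univ z ≤ B := by
  obtain ⟨x, hx, he, -⟩ := I.exists_isGreatest_opt hB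
  have hm : ∀ i, Monotone fun z : ℝ => if I.gamma i ≤ z then (1:ℝ) else 0 := fun i a b hab => by
    dsimp only
    split_ifs <;> first | (exfalso; linarith) | norm_num
  have h1 : ∫ z in (0:ℝ)..Z, I.utilUpTo Finset.univ z =
      ∑ i, I.u i * ∫ z in (0:ℝ)..Z, if I.gamma i ≤ z then (1:ℝ) else 0 := by
    simp_rw [← intervalIntegral.integral_const_mul]
    rw [← intervalIntegral.integral_finsetSum fun i _ => (hm i).intervalIntegrable.const_mul _]
    simp_rw [mul_ite, mul_one, mul_zero, ← utilUpTo_eq_sum_ite]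
  rw [h1, he, Finset.sum_mul, ← Finset.sum_sub_distrib]
  refine (Finset.sum_le_sum fun i _ => ?_).trans hx.2
  have h2 := mul_le_mul_of_nonneg_left
    (mul_sub_le_integral_ite (I.gamma_nonneg i) hZ (hx.1 i).1 (hx.1 i).2) (I.u_nonneg i)
  have h3 := mul_le_mul_of_nonneg_right (I.u_mul_gamma_le i) (hx.1 i).1
  linarith

lemma exists_certificate {f : Rule} {lam : ℝ} (hB : 0 < B)
    (hf : I.IsCertified Finset.univ B f lam) (hlt : I.ruleUtil Finset.univ f < I.opt B) :
    Certificate (I.utilUpTo Finset.univ) (I.ruleUtil Finset.univ f - lam * B) lam (I.opt B) B := by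
  obtain ⟨x, hx, he, -⟩ := I.exists_isGreatest_opt hB.le
  have hlam : 0 < lam := by
    refine hf.lam_nonneg.lt_of_ne fun h0 => hlt.not_ge ?_
    subst h0
    have hM : ∀ i, I.gamma i ≤ ∑ j, I.gamma j := fun i =>
      Finset.single_le_sum (fun j _ => I.gamma_nonneg j) (Finset.mem_univ i)
    have := hf.le_of_nonneg (∑ j, I.gamma j) (Finset.sum_nonneg fun j _ => I.gamma_nonneg j)
    rw [zero_mul, zero_mul, sub_zero, sub_zero, utilUpTo,
      Finset.filter_true_of_mem fun i _ => hM i] at this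
    rw [he]
    exact (Finset.sum_le_sum fun i _ => mul_le_of_le_one_right (I.u_nonneg i) (hx.1 i).2).trans this
  have ha0 : 0 ≤ I.ruleUtil Finset.univ f - lam * B := by
    have := hf.le_of_nonneg 0 le_rfl
    rw [zero_mul, mul_zero, sub_zero] at this
    exact (I.utilUpTo_nonneg _ _).trans this
  refine ⟨ha0.lt_of_ne fun h0 => hlt.not_ge ?_, hlam, ?_, hf.le_of_nonneg,
    fun Z hZ => I.opt_mul_sub_integral_le hB.le hZ⟩
  · have hu : ∀ i, I.u i ≤ lam * I.c i := fun i => by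
      rcases (I.u_nonneg i).eq_or_lt with h | h
      · rw [← h]; exact mul_nonneg hlam.le (I.c_nonneg i)
      · have h1 := hf.le_of_nonneg _ (I.gamma_nonneg i)
        rw [← h0] at h1
        have h2 := I.u_le_utilUpTo_gamma i
        have h3 : 1 ≤ lam * I.gamma i := by
          by_contra hc
          push Not at hc
          nlinarith
        have h4 := mul_le_mul_of_nonneg_left (I.u_mul_gamma_le i) hlam.le
        nlinarith
    rw [he]
    calc ∑ i, I.u i * x i ≤ ∑ i, lam * (I.c i * x i) := Finset.sum_le_sum fun i _ => by
          rw [← mul_assoc]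
          exact mul_le_mul_of_nonneg_right (hu i) (hx.1 i).1
      _ ≤ lam * B := by rw [← Finset.mul_sum]; exact mul_le_mul_of_nonneg_left hx.2 hlam.le
      _ = _ := by linarith
  · have := mul_pos hlam hB
    linarith

end Market

open Market

lemma one_sub_exp_le_greedyRatio (K : Choices) (I : Market) {B : ℝ} (hB : 0 < B) :
    1 - Real.exp (-1) ≤ greedyRatio K I B := by
  obtain ⟨lam, hf⟩ := exists_isCertified_greedyRule K I Finset.univ hB
  have hO := I.opt_pos hB
  rw [greedyRatio, greedyUtility_eq K I hB, le_div_iff₀ hO]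
  by_cases hlt : I.ruleUtil Finset.univ (greedyRule K I Finset.univ B) < I.opt B
  · have := (I.exists_certificate hB hf hlt).one_sub_exp_mul_le (I.utilUpTo_mono _)
    linarith
  · have := mul_pos (Real.exp_pos (-1)) hO
    linarith

lemma exists_greedyRatio_gap {ρ R : ℝ} (hρ : 1 < ρ) (hR : 1 ≤ R) :
    ∃ δ > 0, ∀ (K : Choices) (I : Market) (B₁ B₂ : ℝ), 0 < B₁ → ρ * B₁ ≤ B₂ → B₂ ≤ R * B₁ →
      1 - Real.exp (-1) + δ ≤ greedyRatio K I B₁ ∨ 1 - Real.exp (-1) + δ ≤ greedyRatio K I B₂ := by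
  obtain ⟨δ, hδ, hgap⟩ := exists_gap_of_two_budgets hρ hR
  refine ⟨min δ (Real.exp (-1)), lt_min hδ (Real.exp_pos _), fun K I B₁ B₂ hB₁ hρB hRB => ?_⟩
  have hle : B₁ ≤ B₂ := (le_mul_of_one_le_left hB₁.le hρ.le).trans hρB
  have hB₂ : 0 < B₂ := hB₁.trans_le hle
  by_contra! hcon
  obtain ⟨h1, h2⟩ := hcon
  obtain ⟨lam₁, hf₁⟩ := exists_isCertified_greedyRule K I Finset.univ hB₁
  obtain ⟨lam₂, hf₂⟩ := exists_isCertified_greedyRule K I Finset.univ hB₂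
  have hO₁ := I.opt_pos hB₁
  have hO₂ := I.opt_pos hB₂
  rw [greedyRatio, greedyUtility_eq K I hB₁, div_lt_iff₀ hO₁] at h1
  rw [greedyRatio, greedyUtility_eq K I hB₂, div_lt_iff₀ hO₂] at h2
  have m1 : min δ (Real.exp (-1)) ≤ δ := min_le_left _ _
  have m2 : min δ (Real.exp (-1)) ≤ Real.exp (-1) := min_le_right _ _
  have k1 := mul_le_mul_of_nonneg_right m1 hO₁.le
  have k2 := mul_le_mul_of_nonneg_right m1 hO₂.le
  have k3 := mul_le_mul_of_nonneg_right m2 hO₁.le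
  have k4 := mul_le_mul_of_nonneg_right m2 hO₂.le
  have := hgap _ _ _ _ _ _ _ _ _ (I.utilUpTo_mono _) hB₁ hρB hRB (I.opt_mono hB₁.le hle)
    (I.opt_mul_le hB₁ hle) (I.exists_certificate hB₁ hf₁ (by linarith))
    (I.exists_certificate hB₂ hf₂ (by linarith)) (by linarith)
  linarith

/-- Two sets of budgets of positive probability whose ratios are bounded away from `1` and `∞`. -/
lemma exists_separated_budgets (D : Measure ℝ) (hpos : ∀ᵐ B ∂D, 0 < B)
    (hsupp : D.support.Nontrivial) :
    ∃ (S₁ S₂ : Set ℝ) (ρ R : ℝ), MeasurableSet S₁ ∧ MeasurableSet S₂ ∧ 0 < D S₁ ∧ 0 < D S₂ ∧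
      1 < ρ ∧ 1 ≤ R ∧ ∀ B₁ ∈ S₁, ∀ B₂ ∈ S₂, 0 < B₁ ∧ ρ * B₁ ≤ B₂ ∧ B₂ ≤ R * B₁ := by
  obtain ⟨b, hb, y, hy, hby⟩ := hsupp.exists_lt
  obtain ⟨x, ⟨hxy, hx0⟩, hx⟩ : (Set.Iio y ∩ Set.Ioi 0 ∩ D.support).Nonempty := by
    apply Measure.nonempty_inter_support_of_pos
    rw [measure_inter_conull (t := Set.Ioi 0) (mem_ae_iff.1 hpos)]
    exact (Measure.mem_support_iff_forall b).1 hb _ (Iio_mem_nhds hby)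
  simp only [Set.mem_Iio, Set.mem_Ioi] at hxy hx0
  refine ⟨Set.Ioo (x / 2) ((2 * x + y) / 3), Set.Ioo ((x + 2 * y) / 3) (2 * y),
    (x + 2 * y) / (2 * x + y), 4 * y / x, measurableSet_Ioo, measurableSet_Ioo,
    (Measure.mem_support_iff_forall x).1 hx _ (Ioo_mem_nhds (by linarith) (by linarith)),
    (Measure.mem_support_iff_forall y).1 hy _ (Ioo_mem_nhds (by linarith) (by linarith)),
    ?_, ?_, fun B₁ h₁ B₂ h₂ => ⟨by linarith [h₁.1], ?_, ?_⟩⟩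
  · rw [one_lt_div (by linarith)]; linarith
  · rw [one_le_div hx0]; linarith
  · rw [div_mul_eq_mul_div, div_le_iff₀ (by linarith)]
    nlinarith [h₁.2, h₂.1]
  · rw [div_mul_eq_mul_div, le_div_iff₀ hx0]
    nlinarith [h₁.1, h₂.2]

lemma le_lintegral_ofReal_of_gain (D : Measure ℝ) [IsProbabilityMeasure D] {r : ℝ → ℝ}
    {S E : Set ℝ} {c δ θ m : ℝ} (hS : MeasurableSet S) (hE : MeasurableSet E) (hc : 0 ≤ c)
    (hδ : 0 ≤ δ) (hEθ : D.real Eᶜ ≤ θ) (hm : m ≤ D.real S)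
    (hr : ∀ᵐ B ∂D, B ∈ E → c + S.indicator (fun _ => δ) B ≤ r B) :
    ENNReal.ofReal (c * (1 - θ) + δ * (m - θ)) ≤ ∫⁻ B, ENNReal.ofReal (r B) ∂D := by
  have h1 : ∫⁻ B, (E.indicator (fun _ => ENNReal.ofReal c) B +
      (E ∩ S).indicator (fun _ => ENNReal.ofReal δ) B) ∂D ≤ ∫⁻ B, ENNReal.ofReal (r B) ∂D := by
    refine lintegral_mono_ae (hr.mono fun B hB => ?_)
    by_cases hBE : B ∈ E
    · have h := hB hBE
      by_cases hBS : B ∈ S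
      · simp only [Set.indicator, hBE, hBS, Set.mem_inter_iff, and_self, if_true] at h ⊢
        rw [← ENNReal.ofReal_add hc hδ]
        exact ENNReal.ofReal_le_ofReal h
      · simp only [Set.indicator, hBE, hBS, Set.mem_inter_iff, and_false, if_true, if_false,
          add_zero] at h ⊢
        exact ENNReal.ofReal_le_ofReal h
    · simp [hBE]
  refine le_trans ?_ h1
  rw [lintegral_add_left (measurable_const.indicator hE), lintegral_indicator_const hE,
    lintegral_indicator_const (hE.inter hS), ← ofReal_measureReal, ← ofReal_measureReal,
    ← ENNReal.ofReal_mul hc, ← ENNReal.ofReal_mul hδ, ← ENNReal.ofReal_add (by positivity) (by positivity)]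
  apply ENNReal.ofReal_le_ofReal
  have e1 : D.real E = 1 - D.real Eᶜ := by
    rw [probReal_compl_eq_one_sub hE]; ring
  have e2 : D.real S ≤ D.real (E ∩ S) + D.real Eᶜ :=
    (measureReal_mono (fun B hB => by
      by_cases h : B ∈ E
      · exact Or.inl ⟨h, hB⟩
      · exact Or.inr h)).trans (measureReal_union_le _ _)
  have := mul_le_mul_of_nonneg_left (show 1 - θ ≤ D.real E by linarith) hc
  have := mul_le_mul_of_nonneg_left (show m - θ ≤ D.real (E ∩ S) by linarith) hδ
  linarith

/-- A set of budgets of probability at least `m` at which Greedy gains `δ` over `1 - 1/e`. -/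
lemma exists_greedyRatio_gain (D : Measure ℝ) [IsProbabilityMeasure D] (hpos : ∀ᵐ B ∂D, 0 < B)
    (hsupp : D.support.Nontrivial) :
    ∃ δ > 0, ∃ m > 0, ∀ (K : Choices) (I : Market), ∃ S, MeasurableSet S ∧ m ≤ D.real S ∧
      ∀ᵐ B ∂D, 0 < B ∧ 1 - Real.exp (-1) + S.indicator (fun _ => δ) B ≤ greedyRatio K I B := by
  obtain ⟨S₁, S₂, ρ, R, hS₁, hS₂, hp₁, hp₂, hρ, hR, hsep⟩ := exists_separated_budgets D hpos hsupp
  obtain ⟨δ, hδ, hgap⟩ := exists_greedyRatio_gap hρ hR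
  have hr₁ : 0 < D.real S₁ := ENNReal.toReal_pos hp₁.ne' (measure_ne_top _ _)
  have hr₂ : 0 < D.real S₂ := ENNReal.toReal_pos hp₂.ne' (measure_ne_top _ _)
  refine ⟨δ, hδ, min (D.real S₁) (D.real S₂), lt_min hr₁ hr₂, fun K I => ?_⟩
  have hfin : ∀ S : Set ℝ, (∀ B ∈ S, 1 - Real.exp (-1) + δ ≤ greedyRatio K I B) →
      ∀ᵐ B ∂D, 0 < B ∧ 1 - Real.exp (-1) + S.indicator (fun _ => δ) B ≤ greedyRatio K I B := by
    refine fun S hS => hpos.mono fun B hB => ⟨hB, ?_⟩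
    by_cases h : B ∈ S
    · simpa [h] using hS B h
    · simpa [h] using one_sub_exp_le_greedyRatio K I hB
  by_cases h : ∀ B ∈ S₁, 1 - Real.exp (-1) + δ ≤ greedyRatio K I B
  · exact ⟨S₁, hS₁, min_le_left _ _, hfin S₁ h⟩
  · push Not at h
    obtain ⟨B₁, hB₁, hlt⟩ := h
    refine ⟨S₂, hS₂, min_le_right _ _, hfin S₂ fun B₂ hB₂ => ?_⟩
    obtain ⟨h1, h2, h3⟩ := hsep B₁ hB₁ B₂ hB₂
    exact (hgap K I B₁ B₂ h1 h2 h3).resolve_left hlt.not_ge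

lemma one_sub_exp_neg_one_pos : 0 < 1 - Real.exp (-1) := by
  linarith [exp_neg_one_lt_half]

lemma lt_smoothedRatio_greedyRatio (D : Measure ℝ) [IsProbabilityMeasure D]
    (hpos : ∀ᵐ B ∂D, 0 < B) (hsupp : D.support.Nontrivial) (K : Choices) :
    ENNReal.ofReal (1 - Real.exp (-1)) < smoothedRatio D (greedyRatio K) Set.univ := by
  obtain ⟨δ, hδ, m, hm, h⟩ := exists_greedyRatio_gain D hpos hsupp
  have hc := one_sub_exp_neg_one_pos
  refine lt_of_lt_of_le (b := ENNReal.ofReal ((1 - Real.exp (-1)) * (1 - 0) + δ * (m - 0))) ?_ ?_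
  · rw [ENNReal.ofReal_lt_ofReal_iff_of_nonneg hc.le]
    have := mul_pos hδ hm
    linarith
  · refine le_iInf₂ fun I _ => ?_
    obtain ⟨S, hS, hmS, hr⟩ := h K I
    exact le_lintegral_ofReal_of_gain D hS MeasurableSet.univ hc.le hδ.le (by simp) hmS
      (hr.mono fun B hB _ => hB.2)

/-- The second moment of the imbalance of a uniformly random partition. -/
lemma sum_powerset_imbalance_sq {ι : Type*} [DecidableEq ι] (w : ι → ℝ) (N : Finset ι) :
    ∑ X ∈ N.powerset, (2 * ∑ i ∈ X, w i - ∑ i ∈ N, w i) ^ 2 = 2 ^ N.card * ∑ i ∈ N, w i ^ 2 := by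
  induction N using Finset.induction_on with
  | empty => simp
  | insert a N ha ih =>
    rw [Finset.sum_powerset_insert ha, Finset.card_insert_of_notMem ha, Finset.sum_insert ha,
      Finset.sum_insert ha, ← Finset.sum_add_distrib]
    have : ∀ X ∈ N.powerset, (2 * ∑ i ∈ X, w i - (w a + ∑ i ∈ N, w i)) ^ 2 +
        (2 * ∑ i ∈ insert a X, w i - (w a + ∑ i ∈ N, w i)) ^ 2 =
        2 * (2 * ∑ i ∈ X, w i - ∑ i ∈ N, w i) ^ 2 + 2 * w a ^ 2 := fun X hX => by
      rw [Finset.sum_insert fun h => ha (Finset.mem_powerset.1 hX h)]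
      ring
    rw [Finset.sum_congr rfl this, Finset.sum_add_distrib, ← Finset.mul_sum, ih, Finset.sum_const,
      Finset.card_powerset, nsmul_eq_mul]
    push_cast
    ring

namespace Market

variable (I : Market) {N X : Finset (Fin I.n)} {p m s τ d : ℝ}

lemma utilUpTo_sdiff (h : X ⊆ N) (p : ℝ) :
    I.utilUpTo (N \ X) p = I.utilUpTo N p - I.utilUpTo X p := by
  simp only [utilUpTo_eq_sum_ite]
  rw [← Finset.sum_sdiff h]
  ring

/-- `X` contains about half of the utility of `N` at every price at which `N` offers at least
the utility `τ`. -/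
def IsBalanced (I : Market) (N X : Finset (Fin I.n)) (τ d : ℝ) : Prop :=
  ∀ p, τ ≤ I.utilUpTo N p → |2 * I.utilUpTo X p - I.utilUpTo N p| ≤ d * I.utilUpTo N p

lemma IsBalanced.sdiff {I : Market} {N X : Finset (Fin I.n)} (h : I.IsBalanced N X τ d)
    (hX : X ⊆ N) : I.IsBalanced N (N \ X) τ d := fun p hp => by
  rw [I.utilUpTo_sdiff hX, ← abs_neg]
  convert h p hp using 2
  ring

open scoped Classical in
lemma card_imbalanced_mul_le (hs : 0 < s) (hm : ∀ i ∈ N, I.u i ≤ m) (hp : 0 < I.utilUpTo N p) :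
    ((N.powerset.filter fun X => s * I.utilUpTo N p < |2 * I.utilUpTo X p - I.utilUpTo N p|).card
      : ℝ) * (s ^ 2 * I.utilUpTo N p) ≤ 2 ^ N.card * m := by
  set A := N.powerset.filter fun X => s * I.utilUpTo N p < |2 * I.utilUpTo X p - I.utilUpTo N p|
  refine le_of_mul_le_mul_right ?_ hp
  have h1 : (A.card : ℝ) * (s * I.utilUpTo N p) ^ 2 ≤
      ∑ X ∈ N.powerset, (2 * I.utilUpTo X p - I.utilUpTo N p) ^ 2 := by
    rw [← nsmul_eq_mul, ← Finset.sum_const]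
    refine (Finset.sum_le_sum fun X hX => ?_).trans
      (Finset.sum_le_sum_of_subset_of_nonneg (Finset.filter_subset _ _) fun X _ _ => sq_nonneg _)
    rw [← sq_abs (2 * I.utilUpTo X p - I.utilUpTo N p)]
    exact pow_le_pow_left₀ (by positivity) (Finset.mem_filter.1 hX).2.le 2
  have h2 := sum_powerset_imbalance_sq (fun i => if I.gamma i ≤ p then I.u i else 0) N
  simp only [← utilUpTo_eq_sum_ite] at h2
  have h3 : ∑ i ∈ N, (if I.gamma i ≤ p then I.u i else 0) ^ 2 ≤ m * I.utilUpTo N p := by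
    rw [utilUpTo_eq_sum_ite, Finset.mul_sum]
    refine Finset.sum_le_sum fun i hi => ?_
    split_ifs
    · rw [sq]; exact mul_le_mul_of_nonneg_right (hm i hi) (I.u_nonneg i)
    · simp
  have h4 := mul_le_mul_of_nonneg_left h3 (show (0:ℝ) ≤ 2 ^ N.card by positivity)
  linarith

open scoped Classical in
lemma card_imbalanced_level_mul_le (hs : 0 < s) (hs' : s ≤ 1 / 2) (hm0 : 0 ≤ m)
    (hm : ∀ i ∈ N, I.u i ≤ m) (hτ : 0 < τ) :
    ((N.powerset.filter fun X => ∃ p, τ ≤ I.utilUpTo N p ∧ I.utilUpTo N p < τ * (1 + s) ∧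
      2 * s * I.utilUpTo N p < |2 * I.utilUpTo X p - I.utilUpTo N p|).card : ℝ) * (s ^ 2 * τ) ≤
      2 ^ N.card * m := by
  by_cases hex : ∃ p, τ ≤ I.utilUpTo N p ∧ I.utilUpTo N p < τ * (1 + s)
  swap
  · rw [Finset.filter_false_of_mem]
    · simp; positivity
    · rintro X - ⟨p, h1, h2, -⟩
      exact hex ⟨p, h1, h2⟩
  obtain ⟨q, ⟨hq1, hq2⟩, hmin⟩ := exists_minimalFor_of_wellFoundedLT
    (fun p => τ ≤ I.utilUpTo N p ∧ I.utilUpTo N p < τ * (1 + s))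
    (fun p => (N.filter fun i => I.gamma i ≤ p).card) hex
  have hsub : ∀ p, τ ≤ I.utilUpTo N p → I.utilUpTo N p < τ * (1 + s) →
      ∀ i ∈ N, I.gamma i ≤ q → I.gamma i ≤ p := by
    intro p h1 h2 i hi hiq
    rcases le_total q p with h | h
    · exact hiq.trans h
    · have hss : (N.filter fun i => I.gamma i ≤ p) ⊆ N.filter fun i => I.gamma i ≤ q :=
        Finset.monotone_filter_right N fun _ _ h' => h'.trans h
      have := Finset.eq_of_subset_of_card_le hss (hmin ⟨h1, h2⟩ (Finset.card_le_card hss))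
      exact (Finset.mem_filter.1 (this ▸ Finset.mem_filter.2 ⟨hi, hiq⟩ :
        i ∈ N.filter fun i => I.gamma i ≤ p)).2
  have hq0 : 0 < I.utilUpTo N q := hτ.trans_le hq1
  refine le_trans ?_ (I.card_imbalanced_mul_le hs hm hq0)
  refine mul_le_mul (Nat.cast_le.2 (Finset.card_le_card fun X hX => ?_)) (by gcongr)
    (by positivity) (by positivity)
  rw [Finset.mem_filter] at hX ⊢
  obtain ⟨hXN, p, h1, h2, h3⟩ := hX
  refine ⟨hXN, ?_⟩
  rw [Finset.mem_powerset] at hXN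
  by_contra! hc
  have hmono : ∀ Y ⊆ N, I.utilUpTo Y q ≤ I.utilUpTo Y p := fun Y hY =>
    Finset.sum_le_sum_of_subset_of_nonneg (fun i hi => by
      rw [Finset.mem_filter] at hi ⊢
      exact ⟨hi.1, hsub p h1 h2 i (hY hi.1) hi.2⟩) fun i _ _ => I.u_nonneg i
  have m1 := hmono X hXN
  have m2 := hmono (N \ X) Finset.sdiff_subset
  rw [I.utilUpTo_sdiff hXN, I.utilUpTo_sdiff hXN] at m2
  rw [abs_le] at hc
  have k1 : I.utilUpTo N p ≤ (1 + s) * I.utilUpTo N q := by nlinarith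
  have k2 : (1 - 2 * s) * I.utilUpTo N p ≤ (1 - s) * I.utilUpTo N q := by
    have := mul_le_mul_of_nonneg_left k1 (show 0 ≤ 1 - 2 * s by linarith)
    nlinarith [mul_nonneg (sq_nonneg s) hq0.le]
  refine absurd h3 (not_lt.2 ?_)
  rw [abs_le]
  constructor <;> linarith [hc.1, hc.2]

open scoped Classical in
/-- Few partitions are unbalanced when every single utility is small compared with `τ`. -/
lemma card_not_isBalanced_le {η : ℝ} (hs : 0 < s) (hs' : s ≤ 1 / 2) (hη : 0 ≤ η) (hτ : 0 < τ)
    (hm : ∀ i ∈ N, I.u i ≤ η * τ) :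
    ((N.powerset.filter fun X => ¬ I.IsBalanced N X τ (2 * s)).card : ℝ) ≤
      2 ^ N.card * (η * (1 + s) / s ^ 3) := by
  obtain ⟨M, hM⟩ := pow_unbounded_of_one_lt ((∑ i ∈ N, I.u i) / τ) (show 1 < 1 + s by linarith)
  rw [div_lt_iff₀ hτ] at hM
  let bad : ℕ → Finset (Finset (Fin I.n)) := fun k => N.powerset.filter fun X =>
    ∃ p, τ * (1 + s) ^ k ≤ I.utilUpTo N p ∧ I.utilUpTo N p < τ * (1 + s) ^ k * (1 + s) ∧
      2 * s * I.utilUpTo N p < |2 * I.utilUpTo X p - I.utilUpTo N p|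
  have hsub : (N.powerset.filter fun X => ¬ I.IsBalanced N X τ (2 * s)) ⊆
      (Finset.range M).biUnion bad := by
    intro X hX
    obtain ⟨hXN, hX⟩ := Finset.mem_filter.1 hX
    unfold IsBalanced at hX
    push Not at hX
    obtain ⟨p, hp, hdev⟩ := hX
    obtain ⟨k, hk1, hk2⟩ := exists_nat_pow_near ((one_le_div hτ).2 hp)
      (show 1 < 1 + s by linarith)
    rw [le_div_iff₀ hτ] at hk1
    rw [div_lt_iff₀ hτ, pow_succ] at hk2
    refine Finset.mem_biUnion.2 ⟨k, Finset.mem_range.2 ?_,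
      Finset.mem_filter.2 ⟨hXN, p, by linarith, by linarith, hdev⟩⟩
    have : I.utilUpTo N p ≤ ∑ i ∈ N, I.u i := Finset.sum_le_sum_of_subset_of_nonneg
      (Finset.filter_subset _ _) fun i _ _ => I.u_nonneg i
    exact (pow_lt_pow_iff_right₀ (show 1 < 1 + s by linarith)).1
      (lt_of_mul_lt_mul_right (hk1.trans_lt (this.trans_lt hM)) hτ.le)
  have hbad : ∀ k, ((bad k).card : ℝ) ≤ 2 ^ N.card * (η / s ^ 2) * ((1 + s)⁻¹) ^ k := fun k => by
    have hpos : 0 < (1 + s) ^ k := by positivity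
    have := I.card_imbalanced_level_mul_le (τ := τ * (1 + s) ^ k) hs hs' (by positivity) hm
      (by positivity)
    rw [inv_pow, ← div_eq_mul_inv, le_div_iff₀ hpos]
    refine le_of_mul_le_mul_right (this.trans_eq' ?_ |>.trans_eq ?_)
      (show 0 < s ^ 2 * τ by positivity)
    · ring
    · field_simp
  have hr : (1 + s)⁻¹ < 1 := inv_lt_one_of_one_lt₀ (by linarith)
  have hr0 : 0 ≤ (1 + s)⁻¹ := by positivity
  calc ((N.powerset.filter fun X => ¬ I.IsBalanced N X τ (2 * s)).card : ℝ)
      ≤ ((Finset.range M).biUnion bad).card := Nat.cast_le.2 (Finset.card_le_card hsub)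
    _ ≤ ∑ k ∈ Finset.range M, ((bad k).card : ℝ) := by exact_mod_cast Finset.card_biUnion_le
    _ ≤ ∑ k ∈ Finset.range M, 2 ^ N.card * (η / s ^ 2) * ((1 + s)⁻¹) ^ k :=
        Finset.sum_le_sum fun k _ => hbad k
    _ = 2 ^ N.card * (η / s ^ 2) * ∑ k ∈ Finset.range M, ((1 + s)⁻¹) ^ k := by
        rw [Finset.mul_sum]
    _ ≤ 2 ^ N.card * (η / s ^ 2) * (1 - (1 + s)⁻¹)⁻¹ := by
        gcongr
        rw [← tsum_geometric_of_lt_one hr0 hr]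
        exact (summable_geometric_of_lt_one hr0 hr).sum_le_tsum _ fun k _ => by positivity
    _ = 2 ^ N.card * (η * (1 + s) / s ^ 3) := by
        have : 1 - (1 + s)⁻¹ = s / (1 + s) := by field_simp; ring
        rw [this, inv_div]
        field_simp

end Market

namespace Rule

lemma alloc_eq_indicator (f : Rule) (h : f.p₁ ≤ f.p₂) :
    f.alloc = fun z => (Set.Iic f.p₁).indicator (fun _ => 1 - f.t) z +
      (Set.Iic f.p₂).indicator (fun _ => f.t) z := by
  ext z
  simp only [alloc, Set.indicator, Set.mem_Iic]
  split_ifs <;> first | (exfalso; linarith) | ring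

lemma setIntegral_Ioi_indicator_Iic (γ p a : ℝ) :
    ∫ z in Set.Ioi γ, (Set.Iic p).indicator (fun _ => a) z = max (p - γ) 0 * a := by
  rw [setIntegral_indicator measurableSet_Iic, Set.Ioi_inter_Iic, setIntegral_const,
    Real.volume_real_Ioc, smul_eq_mul]

lemma integrableOn_Ioi_indicator_Iic (γ p a : ℝ) :
    IntegrableOn ((Set.Iic p).indicator (fun _ => a)) (Set.Ioi γ) := by
  rw [IntegrableOn, integrable_indicator_iff measurableSet_Iic, IntegrableOn,
    Measure.restrict_restrict measurableSet_Iic, Set.Iic_inter_Ioi]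
  exact integrableOn_const (by simp)

/-- Myerson's payments are those of a mixture of two posted prices. -/
lemma pay_eq (f : Rule) (h : f.p₁ ≤ f.p₂) (γ : ℝ) :
    f.pay γ = (1 - f.t) * (if γ ≤ f.p₁ then f.p₁ else 0) +
      f.t * (if γ ≤ f.p₂ then f.p₂ else 0) := by
  rw [pay, f.alloc_eq_indicator h, integral_add (integrableOn_Ioi_indicator_Iic _ _ _)
    (integrableOn_Ioi_indicator_Iic _ _ _), setIntegral_Ioi_indicator_Iic,
    setIntegral_Ioi_indicator_Iic]
  simp only [Set.indicator, Set.mem_Iic]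
  split_ifs with h1 h2 h2
  · rw [max_eq_left (by linarith), max_eq_left (by linarith)]; ring
  · exfalso; linarith
  · rw [max_eq_right (by linarith), max_eq_left (by linarith)]; ring
  · rw [max_eq_right (by linarith), max_eq_right (by linarith)]; ring

lemma pay_nonneg {f : Rule} (h : f.p₁ ≤ f.p₂) (h0 : 0 ≤ f.t) (h1 : f.t ≤ 1) {γ : ℝ} (hγ : 0 ≤ γ) :
    0 ≤ f.pay γ := by
  rw [f.pay_eq h]
  have : ∀ p, 0 ≤ if γ ≤ p then p else 0 := fun p => by
    split_ifs with h
    · exact hγ.trans h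
    · exact le_rfl
  exact add_nonneg (mul_nonneg (by linarith) (this _)) (mul_nonneg h0 (this _))

lemma alloc_nonneg {f : Rule} (h0 : 0 ≤ f.t) (γ : ℝ) : 0 ≤ f.alloc γ := by
  unfold alloc
  split_ifs
  exacts [zero_le_one, h0, le_rfl]

end Rule

open Market

lemma sum_mul_pay (I : Market) (S : Finset (Fin I.n)) {f : Rule} (h : f.p₁ ≤ f.p₂) :
    ∑ i ∈ S, I.u i * f.pay (I.gamma i) = I.rulePay S f := by
  simp only [rulePay, utilUpTo_eq_sum_ite, Finset.mul_sum, ← Finset.sum_add_distrib]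
  refine Finset.sum_congr rfl fun i _ => ?_
  rw [f.pay_eq h]
  split_ifs <;> ring

lemma buySeq_nonneg (I : Market) {f : Rule} (h0 : 0 ≤ f.t) (limit spent : ℝ)
    (l : List (Fin I.n)) : 0 ≤ buySeq I f limit spent l := by
  induction l generalizing spent with
  | nil => exact le_rfl
  | cons i l ih =>
    rw [buySeq]
    split_ifs
    · exact add_nonneg (mul_nonneg (I.u_nonneg i) (f.alloc_nonneg h0 _)) (ih _)
    · exact le_rfl

lemma buySeq_eq_sum (I : Market) {f : Rule} {limit spent : ℝ} {l : List (Fin I.n)}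
    (hpay : ∀ i, 0 ≤ I.u i * f.pay (I.gamma i))
    (hl : spent + (l.map fun i => I.u i * f.pay (I.gamma i)).sum ≤ limit) :
    buySeq I f limit spent l = (l.map fun i => I.u i * f.alloc (I.gamma i)).sum := by
  induction l generalizing spent with
  | nil => rfl
  | cons i l ih =>
    rw [List.map_cons, List.sum_cons] at hl
    have : 0 ≤ (l.map fun i => I.u i * f.pay (I.gamma i)).sum :=
      List.sum_nonneg fun x hx => by
        obtain ⟨j, -, rfl⟩ := List.mem_map.1 hx
        exact hpay j
    rw [buySeq, if_pos (by linarith), List.map_cons, List.sum_cons, ih (by linarith)]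

lemma sum_map_order (K : Choices) (I : Market) (S : Finset (Fin I.n)) (g : Fin I.n → ℝ) :
    ((K.order I S).map g).sum = ∑ i ∈ S, g i := by
  rw [← List.sum_toFinset g (K.order_nodup I S)]
  congr 1
  ext i
  simp [K.mem_order]

/-- A rule whose total payment respects the limit is applied to all sellers. -/
lemma buySeq_order_eq (K : Choices) (I : Market) (S : Finset (Fin I.n)) {f : Rule} {limit : ℝ}
    (h : f.p₁ ≤ f.p₂) (h0 : 0 ≤ f.t) (h1 : f.t ≤ 1) (hl : I.rulePay S f ≤ limit) :
    buySeq I f limit 0 (K.order I S) = I.ruleUtil S f := by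
  rw [buySeq_eq_sum, sum_map_order, sum_mul_alloc I S h]
  · exact fun i => mul_nonneg (I.u_nonneg i) (Rule.pay_nonneg h h0 h1 (I.gamma_nonneg i))
  · rwa [sum_map_order, sum_mul_pay I S h, zero_add]

namespace Market

variable {I : Market} {N X : Finset (Fin I.n)} {τ d p : ℝ}

lemma IsBalanced.mul_le_mul_sdiff (h : I.IsBalanced N X τ d) (hX : X ⊆ N) (hd : 0 ≤ d) (hd1 : d ≤ 1)
    (hp : τ ≤ I.utilUpTo N p) :
    (1 - d) * I.utilUpTo X p ≤ (1 + d) * I.utilUpTo (N \ X) p := by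
  rw [I.utilUpTo_sdiff hX]
  have := abs_le.1 (h p hp)
  have h1 := mul_le_mul_of_nonneg_left this.2 (show 0 ≤ 1 - d by linarith)
  have h2 := mul_le_mul_of_nonneg_left this.2 (show 0 ≤ 1 + d by linarith)
  linarith

lemma IsBalanced.mul_sdiff_le_mul (h : I.IsBalanced N X τ d) (hX : X ⊆ N) (hd : 0 ≤ d) (hd1 : d ≤ 1)
    (hp : τ ≤ I.utilUpTo N p) :
    (1 - d) * I.utilUpTo (N \ X) p ≤ (1 + d) * I.utilUpTo X p := by
  have := (h.sdiff hX).mul_le_mul_sdiff Finset.sdiff_subset hd hd1 hp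
  rwa [Finset.sdiff_sdiff_eq_self hX] at this

lemma utilUpTo_neg_one (S : Finset (Fin I.n)) : I.utilUpTo S (-1) = 0 := by
  rw [utilUpTo, Finset.filter_false_of_mem, Finset.sum_empty]
  intro i _
  linarith [I.gamma_nonneg i]

end Market

section Cross

variable (K : Choices) (P : RSGParams) (I : Market) {B d : ℝ} {X : Finset (Fin I.n)}

lemma crossUtility_nonneg (hB : 0 < B) (X Y : Finset (Fin I.n)) :
    0 ≤ crossUtility K P I B X Y := by
  obtain ⟨lam, hf⟩ := exists_isCertified_greedyRule K I X
    (show 0 < (1 - P.δ₁) * B / 2 by have := mul_pos (sub_pos.2 P.δ₁_lt_one) hB; linarith)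
  refine buySeq_nonneg I ?_ _ _ _
  unfold truncate
  split_ifs <;> exact hf.t_nonneg

/-- On a balanced partition the rule of one part keeps most of its utility on the other part. -/
lemma le_crossUtility (hB : 0 < B) (hd : 0 ≤ d) (hd1 : d < 1)
    (hP : (1 + d) * (1 - P.δ₁) ≤ (1 - d) * (1 - P.ε₁))
    (hX : X ⊆ Finset.univ \ K.top I P.C)
    (hbal : I.IsBalanced (Finset.univ \ K.top I P.C) X
      ((∑ i ∈ K.top I P.C, I.u i) / (P.η * P.C)) d) :
    (1 - d) * (I.ruleUtil X (greedyRule K I X ((1 - P.δ₁) * B / 2)) -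
      (∑ i ∈ K.top I P.C, I.u i) / (P.η * P.C)) ≤
      (1 + d) * crossUtility K P I B X ((Finset.univ \ K.top I P.C) \ X) := by
  have hnn := crossUtility_nonneg K P I hB X ((Finset.univ \ K.top I P.C) \ X)
  have hb : 0 < (1 - P.δ₁) * B / 2 := by
    have := mul_pos (sub_pos.2 P.δ₁_lt_one) hB
    linarith
  obtain ⟨lam, hf⟩ := exists_isCertified_greedyRule K I X hb
  unfold crossUtility at hnn ⊢
  unfold truncate at hnn ⊢
  set N := Finset.univ \ K.top I P.C
  set f := greedyRule K I X ((1 - P.δ₁) * B / 2)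
  set τ := (∑ i ∈ K.top I P.C, I.u i) / (P.η * P.C)
  have ht := hf.t_nonneg
  have ht1 := hf.t_le_one
  have hp1 := hf.p₁_nonneg
  have hp12 := hf.p₁_le_p₂
  have hpay := hf.pay_le
  have hlim := mul_le_mul_of_nonneg_right hP hB.le
  have hXN := I.utilUpTo_le_of_subset hX
  have hU1 := I.utilUpTo_nonneg X f.p₁
  rcases lt_or_ge (I.utilUpTo N f.p₂) τ with h2 | h2
  · have h3 : I.ruleUtil X f ≤ I.utilUpTo X f.p₂ := by
      have := mul_le_mul_of_nonneg_left (I.utilUpTo_mono X hp12) (sub_nonneg.2 ht1)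
      unfold ruleUtil
      linarith
    have h4 := mul_nonneg (sub_nonneg.2 hd1.le) (show 0 ≤ τ - I.ruleUtil X f by
      linarith [hXN f.p₂])
    have h5 := mul_nonneg (show 0 ≤ 1 + d by linarith) hnn
    linarith
  · have k1 := mul_le_mul_of_nonneg_left (hbal.mul_le_mul_sdiff hX hd hd1.le h2) ht
    have k2 := mul_le_mul_of_nonneg_left (mul_le_mul_of_nonneg_left
      (hbal.mul_sdiff_le_mul hX hd hd1.le h2) (hp1.trans hp12)) ht
    unfold rulePay at hpay
    have hpay' := mul_le_mul_of_nonneg_left hpay (show 0 ≤ 1 + d by linarith)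
    split_ifs with h1
    · rw [buySeq_order_eq K I _ (f := ⟨f.t, -1, f.p₂⟩) (show (-1 : ℝ) ≤ f.p₂ by linarith) ht ht1]
      · simp only [ruleUtil, utilUpTo_neg_one]
        have h3 : (1 - f.t) * I.utilUpTo X f.p₁ ≤ τ :=
          (mul_le_of_le_one_left hU1 (by linarith)).trans ((hXN _).trans h1.le)
        have := mul_le_mul_of_nonneg_left h3 (sub_nonneg.2 hd1.le)
        linarith
      · simp only [rulePay, utilUpTo_neg_one]
        refine le_of_mul_le_mul_left ?_ (sub_pos.2 hd1)
        have : 0 ≤ (1 + d) * ((1 - f.t) * (f.p₁ * I.utilUpTo X f.p₁)) :=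
          mul_nonneg (by linarith) (mul_nonneg (by linarith) (mul_nonneg hp1 hU1))
        linarith
    · push Not at h1
      have l1 := mul_le_mul_of_nonneg_left (hbal.mul_le_mul_sdiff hX hd hd1.le h1)
        (sub_nonneg.2 ht1)
      have l2 := mul_le_mul_of_nonneg_left (mul_le_mul_of_nonneg_left
        (hbal.mul_sdiff_le_mul hX hd hd1.le h1) hp1) (sub_nonneg.2 ht1)
      have hτ : 0 ≤ τ := div_nonneg (Finset.sum_nonneg fun i _ => I.u_nonneg i)
        (mul_nonneg P.η_pos.le (Nat.cast_nonneg _))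
      rw [buySeq_order_eq K I _ hp12 ht ht1]
      · unfold ruleUtil
        have := mul_nonneg (sub_nonneg.2 hd1.le) hτ
        linarith
      · unfold rulePay
        refine le_of_mul_le_mul_left ?_ (sub_pos.2 hd1)
        linarith

end Cross

/-- The greedy rule of a balanced sample has almost half of the utility of the whole market. -/
lemma le_ruleUtil_of_isBalanced (K : Choices) (I : Market) {T X : Finset (Fin I.n)}
    {B b τ d s : ℝ} (hB : 0 < B) (hb : 0 < b) (hd : 0 ≤ d) (hd1 : d ≤ 1) (hs : 0 ≤ s) (hs1 : s ≤ 1)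
    (hτ : 0 ≤ τ) (hsb : s * (1 + d) * B ≤ 2 * b) (hbal : I.IsBalanced (Finset.univ \ T) X τ d) :
    s * (1 - d) * (greedyUtility K I B - ∑ i ∈ T, I.u i - τ) ≤
      2 * I.ruleUtil X (greedyRule K I X b) := by
  obtain ⟨lam, hf⟩ := exists_isCertified_greedyRule K I X hb
  obtain ⟨mu, hg⟩ := exists_isCertified_greedyRule K I Finset.univ hB
  rw [greedyUtility_eq K I hB]
  set f := greedyRule K I X b
  set g := greedyRule K I Finset.univ B
  set N := Finset.univ \ T
  have hlam := hf.lam_nonneg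
  have ha : 0 ≤ I.ruleUtil X f - lam * b := by
    have := hf.le_of_nonneg 0 le_rfl
    rw [zero_mul, mul_zero, sub_zero] at this
    exact (I.utilUpTo_nonneg _ _).trans this
  have hT : ∀ p, I.utilUpTo Finset.univ p ≤ I.utilUpTo N p + ∑ i ∈ T, I.u i := fun p => by
    have h1 := I.utilUpTo_sdiff (Finset.subset_univ T) p
    have h2 : I.utilUpTo T p ≤ ∑ i ∈ T, I.u i := Finset.sum_le_sum_of_subset_of_nonneg
      (Finset.filter_subset _ _) fun i _ _ => I.u_nonneg i
    linarith
  have key : ∀ p, 0 ≤ p → (1 - d) * (I.utilUpTo Finset.univ p - ∑ i ∈ T, I.u i - τ) ≤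
      2 * (I.ruleUtil X f - lam * b) + lam * ((1 + d) * (p * I.utilUpTo Finset.univ p)) := by
    intro p hp
    have hN := I.utilUpTo_le_of_subset (Finset.subset_univ N) p
    have hpU := mul_nonneg hp (I.utilUpTo_nonneg Finset.univ p)
    rcases lt_or_ge (I.utilUpTo N p) τ with h | h
    · have h1 := mul_nonneg (sub_nonneg.2 hd1) (show 0 ≤ -(I.utilUpTo Finset.univ p -
        ∑ i ∈ T, I.u i - τ) by linarith [hT p])
      have h2 := mul_nonneg hlam (mul_nonneg (show 0 ≤ 1 + d by linarith) hpU)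
      linarith
    · have h1 := abs_le.1 (hbal p h)
      have h2 := hf.le_of_nonneg p hp
      have h3 : I.utilUpTo X p * 2 ≤ (1 + d) * I.utilUpTo Finset.univ p := by
        have := mul_le_mul_of_nonneg_left hN (show 0 ≤ 1 + d by linarith)
        linarith [h1.2]
      have h4 := mul_le_mul_of_nonneg_left (mul_le_mul_of_nonneg_left h3 hp) hlam
      have h5 := mul_le_mul_of_nonneg_left (hT p) (sub_nonneg.2 hd1)
      have h6 := mul_nonneg (sub_nonneg.2 hd1) hτ
      linarith [h1.1]
  have k1 := mul_le_mul_of_nonneg_left (key _ hg.p₁_nonneg) (sub_nonneg.2 hg.t_le_one)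
  have k2 := mul_le_mul_of_nonneg_left (key _ (hg.p₁_nonneg.trans hg.p₁_le_p₂)) hg.t_nonneg
  have k3 := mul_le_mul_of_nonneg_left hg.pay_le
    (mul_nonneg hlam (show 0 ≤ 1 + d by linarith))
  have k4 : (1 - d) * (I.ruleUtil Finset.univ g - ∑ i ∈ T, I.u i - τ) ≤
      2 * (I.ruleUtil X f - lam * b) + lam * (1 + d) * B := by
    refine le_trans ?_ (add_le_add_right k3 _)
    unfold ruleUtil at k1 k2 ⊢
    unfold rulePay
    linarith
  have k5 := mul_le_mul_of_nonneg_left k4 hs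
  have k6 := mul_le_mul_of_nonneg_left hsb hlam
  have k7 := mul_nonneg (sub_nonneg.2 hs1) ha
  linarith

open Market

lemma sum_top_pos (K : Choices) (I : Market) {C : ℕ} (hC : 0 < C) : 0 < ∑ i ∈ K.top I C, I.u i := by
  obtain ⟨j, hj⟩ := I.exists_u_pos
  by_cases hjT : j ∈ K.top I C
  · exact Finset.sum_pos' (fun i _ => I.u_nonneg i) ⟨j, hjT, hj⟩
  · have hcard : 0 < (K.top I C).card := by
      rw [K.top_card]
      exact lt_min hC (Fin.pos j)
    obtain ⟨i, hi⟩ := Finset.card_pos.1 hcard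
    exact Finset.sum_pos' (fun i _ => I.u_nonneg i) ⟨i, hi, hj.trans_le (K.top_spec I C i hi j hjT)⟩

lemma u_mul_le_sum_top (K : Choices) (I : Market) {C : ℕ} {i : Fin I.n} (hi : i ∉ K.top I C) :
    I.u i * C ≤ ∑ j ∈ K.top I C, I.u j := by
  have hcard : (K.top I C).card = C := by
    have h1 : (K.top I C).card < I.n := by
      refine (Finset.card_lt_card ?_).trans_eq (Finset.card_fin I.n)
      exact (Finset.ssubset_univ_iff.2 fun h => hi (h ▸ Finset.mem_univ i))
    have h2 := K.top_card I C
    omega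
  calc I.u i * C = ∑ _j ∈ K.top I C, I.u i := by
        rw [Finset.sum_const, hcard, nsmul_eq_mul, mul_comm]
    _ ≤ _ := Finset.sum_le_sum fun j hj => K.top_spec I C j hj i hi

lemma le_rsgUtility_of_le_crossUtility (K : Choices) (P : RSGParams) (I : Market) {B W π : ℝ}
    (hB : 0 < B) (hW : 0 ≤ W) {good : Finset (Fin I.n) → Prop} [DecidablePred good]
    (hc : ∀ i, I.c i ≤ P.ε₁ * B / P.C)
    (hbad : (((Finset.univ \ K.top I P.C).powerset.filter fun X => ¬ good X).card : ℝ) ≤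
      2 ^ (Finset.univ \ K.top I P.C).card * π)
    (hgood : ∀ X ⊆ Finset.univ \ K.top I P.C, good X →
      W ≤ crossUtility K P I B X ((Finset.univ \ K.top I P.C) \ X) +
        crossUtility K P I B ((Finset.univ \ K.top I P.C) \ X) X) :
    ∑ i ∈ K.top I P.C, I.u i + (1 - π) * W ≤ rsgUtility K P I B := by
  unfold rsgUtility
  rw [Finset.filter_true_of_mem fun i _ => hc i]
  set N := Finset.univ \ K.top I P.C
  refine add_le_add_right ?_ _
  have h2 : (0:ℝ) < 2 ^ N.card := by positivity
  rw [le_div_iff₀ h2]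
  have hsplit : ((N.powerset.filter good).card : ℝ) +
      ((N.powerset.filter fun X => ¬ good X).card : ℝ) = 2 ^ N.card := by
    rw [← Nat.cast_add, Finset.card_filter_add_card_filter_not, Finset.card_powerset]
    push_cast
    rfl
  calc (1 - π) * W * 2 ^ N.card ≤ ((N.powerset.filter good).card : ℝ) * W := by
        have := mul_le_mul_of_nonneg_right hbad hW
        have e : ((N.powerset.filter good).card : ℝ) =
          2 ^ N.card - ((N.powerset.filter fun X => ¬ good X).card : ℝ) := by linarith
        rw [e]
        linarith
    _ = ∑ X ∈ N.powerset.filter good, W := by rw [Finset.sum_const, nsmul_eq_mul]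
    _ ≤ ∑ X ∈ N.powerset.filter good,
        (crossUtility K P I B X (N \ X) + crossUtility K P I B (N \ X) X) :=
        Finset.sum_le_sum fun X hX => by
          obtain ⟨h1, h2⟩ := Finset.mem_filter.1 hX
          exact hgood X (Finset.mem_powerset.1 h1) h2
    _ ≤ _ := Finset.sum_le_sum_of_subset_of_nonneg (Finset.filter_subset _ _) fun X _ _ =>
        add_nonneg (crossUtility_nonneg K P I hB _ _) (crossUtility_nonneg K P I hB _ _)

/-- Random-Sampling-Greedy loses an arbitrarily small fraction of the utility of Greedy when all
costs are small compared with the budget. -/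
theorem exists_params_le_rsgUtility {d : ℝ} (hd : 0 < d) (hd1 : d ≤ 1 / 2) :
    ∃ (P : RSGParams) (θ : ℝ), 0 < θ ∧ ∀ (K : Choices) (I : Market) (B : ℝ), 0 < B →
      (∀ i, I.c i ≤ θ * B) → (1 - 8 * d) * greedyUtility K I B ≤ rsgUtility K P I B := by
  classical
  set s := d / 2 with hs
  have hs0 : 0 < s := by positivity
  set η := d * s ^ 3 / (1 + s) with hη
  have hη0 : 0 < η := by positivity
  have hdl : 0 < 1 - d := by linarith
  obtain ⟨C, hC⟩ := exists_nat_gt (3 / (η * d))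
  have hC0 : 0 < C := by
    have : (0:ℝ) < C := lt_trans (by positivity) hC
    exact_mod_cast this
  have hCr : (0:ℝ) < C := by exact_mod_cast hC0
  have hq : (1 - d) ^ 2 / (1 + d) < 1 := by
    rw [div_lt_one (by linarith)]
    nlinarith
  let P : RSGParams :=
    { ε₁ := d, δ₁ := 1 - (1 - d) ^ 2 / (1 + d), η := η, C := C
      ε₁_pos := hd, ε₁_lt_one := by linarith, δ₁_pos := by linarith
      δ₁_lt_one := by
        have : 0 < (1 - d) ^ 2 / (1 + d) := by positivity
        linarith
      η_pos := hη0, C_pos := hC0 }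
  refine ⟨P, d / C, by positivity, fun K I B hB hc => ?_⟩
  set UT := ∑ i ∈ K.top I C, I.u i with hUT
  have hUT0 : 0 < UT := sum_top_pos K I hC0
  set τ := UT / (η * C) with hτ
  have hτ0 : 0 < τ := by positivity
  have hτd : 3 * τ ≤ d * UT := by
    rw [div_lt_iff₀ (by positivity)] at hC
    rw [hτ, mul_div_assoc', div_le_iff₀ (by positivity)]
    nlinarith
  set N := Finset.univ \ K.top I C with hN
  set v := greedyUtility K I B with hv
  have hv0 : 0 ≤ v := by
    obtain ⟨lam, hf⟩ := exists_isCertified_greedyRule K I Finset.univ hB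
    exact Finset.sum_nonneg fun i _ => mul_nonneg (I.u_nonneg i) (Rule.alloc_nonneg hf.t_nonneg _)
  set κ := (1 - d) / (1 + d) with hκ
  have hκ0 : 0 < κ := by positivity
  have hκ1 : κ ≤ 1 := (div_le_one (by linarith)).2 (by linarith)
  set k := κ * (κ ^ 2 * (1 - d)) with hk
  have hk0 : 0 < k := by positivity
  have hk1 : k ≤ 1 - d := by
    have : κ * κ ^ 2 ≤ 1 := mul_le_one₀ hκ1 (by positivity) (pow_le_one₀ hκ0.le hκ1)
    rw [hk, ← mul_assoc]
    exact mul_le_of_le_one_left hdl.le this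
  have hbad := I.card_not_isBalanced_le (N := N) (η := η) (τ := τ) hs0 (by linarith) hη0.le hτ0
    fun i hi => by
      have h1 := u_mul_le_sum_top K I (Finset.mem_sdiff.1 hi).2
      have h2 : η * τ = UT / C := by rw [hτ]; field_simp
      rwa [h2, le_div_iff₀ hCr]
  have h2s : 2 * s = d := by rw [hs]; ring
  have hπ : η * (1 + s) / s ^ 3 = d := by rw [hη]; field_simp
  rw [hπ, h2s] at hbad
  have hhalf : ∀ X ⊆ N, I.IsBalanced N X τ d →
      k * (v - UT - τ) / 2 - τ ≤ crossUtility K P I B X (N \ X) := by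
    intro X hX hbal
    have h1 := le_crossUtility K P I hB hd.le (by linarith)
      (le_of_eq (by simp only [P]; field_simp; ring)) hX hbal
    have h2 := le_ruleUtil_of_isBalanced K I (T := K.top I C) (b := (1 - P.δ₁) * B / 2)
      (s := κ ^ 2) hB (by have := mul_pos (sub_pos.2 P.δ₁_lt_one) hB; linarith) hd.le
      (by linarith) (by positivity) (pow_le_one₀ hκ0.le hκ1) hτ0.le
      (le_of_eq (by simp only [P, hκ]; field_simp; ring)) hbal
    have h3 : κ * (I.ruleUtil X (greedyRule K I X ((1 - P.δ₁) * B / 2)) - τ) ≤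
        crossUtility K P I B X (N \ X) := by
      rw [hκ, div_mul_eq_mul_div, div_le_iff₀ (by linarith)]
      linarith
    have h4 := mul_le_mul_of_nonneg_left h2 hκ0.le
    have h5 := mul_le_mul_of_nonneg_right hκ1 hτ0.le
    rw [hk]
    linarith
  have hrsg := le_rsgUtility_of_le_crossUtility K P I hB
    (le_max_right (k * (v - UT) - d * UT) 0) (good := fun X => I.IsBalanced N X τ d)
    (fun i => (hc i).trans_eq (by simp only [P]; ring)) hbad fun X hX hbal => by
      refine max_le ?_ (add_nonneg (crossUtility_nonneg K P I hB _ _)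
        (crossUtility_nonneg K P I hB _ _))
      have h1 := hhalf X hX hbal
      have h2 := hhalf (N \ X) Finset.sdiff_subset (hbal.sdiff hX)
      rw [Finset.sdiff_sdiff_eq_self hX] at h2
      have h3 := mul_le_mul_of_nonneg_right (hk1.trans (show 1 - d ≤ 1 by linarith)) hτ0.le
      change _ ≤ crossUtility K P I B X (N \ X) + crossUtility K P I B (N \ X) X
      linarith
  refine le_trans ?_ hrsg
  have hm := mul_le_mul_of_nonneg_left (le_max_left (k * (v - UT) - d * UT) 0) hdl.le
  have hfactor : 1 - 8 * d ≤ (1 - d) * k := by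
    have h1 : (1 - d) * k = (1 - d) ^ 5 / (1 + d) ^ 3 := by
      rw [hk, hκ]; field_simp
    rw [h1, le_div_iff₀ (by positivity)]
    have h2 := one_add_mul_le_pow (show -2 ≤ -d by linarith) 5
    have h3 : (1 - 8 * d) * (1 + d) ^ 3 = 1 - 5 * d - (21 * d ^ 2 + 23 * d ^ 3 + 8 * d ^ 4) := by
      ring
    have h4 : 0 ≤ 21 * d ^ 2 + 23 * d ^ 3 + 8 * d ^ 4 := by positivity
    push_cast at h2
    rw [← sub_eq_add_neg] at h2
    linarith
  have h6 := mul_le_mul_of_nonneg_right hfactor hv0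
  have h7 : 0 ≤ UT * (1 - (1 - d) * (k + d)) := by
    refine mul_nonneg hUT0.le ?_
    nlinarith
  change _ ≤ UT + _
  linarith

lemma measurableSet_forall_cost_le (I : Market) (θ : ℝ) :
    MeasurableSet {B : ℝ | ∀ i, I.c i ≤ θ * B} := by
  rw [Set.ofPred_forall]
  exact MeasurableSet.iInter fun i => measurableSet_le measurable_const (by fun_prop)

lemma exists_lt_smoothedRatio_rsgRatio (D : Measure ℝ) [IsProbabilityMeasure D]
    (hpos : ∀ᵐ B ∂D, 0 < B) (hsupp : D.support.Nontrivial) :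
    ∃ (P : RSGParams) (θ : ℝ), 0 < θ ∧ ∀ K : Choices,
      ENNReal.ofReal (1 - Real.exp (-1)) <
        smoothedRatio D (rsgRatio K P) (smallBidderMarkets D θ) := by
  obtain ⟨δ, hδ, m, hm, h⟩ := exists_greedyRatio_gain D hpos hsupp
  have hc := one_sub_exp_neg_one_pos
  set c := 1 - Real.exp (-1)
  set A := 8 * (c + δ * m) + (c + δ) with hA
  have hA0 : 0 < A := by positivity
  set d := min (1 / 16) (δ * m / (2 * A)) with hd
  have hd0 : 0 < d := by positivity
  have hd16 : d ≤ 1 / 16 := min_le_left _ _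
  have hdA : d * A ≤ δ * m / 2 := by
    have : d ≤ δ * m / (2 * A) := min_le_right _ _
    rw [le_div_iff₀ (by positivity)] at this
    linarith
  obtain ⟨P, θ₀, hθ₀, hP⟩ := exists_params_le_rsgUtility hd0 (by linarith)
  have hθ : 0 < min θ₀ d := lt_min hθ₀ hd0
  refine ⟨P, min θ₀ d, hθ, fun K => ?_⟩
  set θ := min θ₀ d
  have hθd : θ ≤ d := min_le_right _ _
  have h8 : 0 < 1 - 8 * d := by linarith
  refine lt_of_lt_of_le (b := ENNReal.ofReal
    ((1 - 8 * d) * c * (1 - θ) + (1 - 8 * d) * δ * (m - θ))) ?_ (le_iInf₂ fun I hI => ?_)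
  · rw [ENNReal.ofReal_lt_ofReal_iff_of_nonneg hc.le]
    have h1 : (1 - 8 * d) * c * (1 - θ) + (1 - 8 * d) * δ * (m - θ) =
        c + δ * m - 8 * d * (c + δ * m) - (c + δ) * θ + 8 * d * (c + δ) * θ := by ring
    have h2 : (c + δ) * θ ≤ (c + δ) * d := mul_le_mul_of_nonneg_left hθd (by positivity)
    have h3 : 0 ≤ 8 * d * (c + δ) * θ := by positivity
    have h4 := mul_pos hδ hm
    rw [hA] at hdA
    linarith
  · obtain ⟨S, hS, hmS, hr⟩ := h K I
    refine le_lintegral_ofReal_of_gain D (E := {B : ℝ | ∀ i, I.c i ≤ θ * B}) hS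
      (measurableSet_forall_cost_le I θ) (mul_nonneg h8.le hc.le) (mul_nonneg h8.le hδ.le) ?_ hmS
      (hr.mono fun B hB hBE => ?_)
    · have : {B : ℝ | ∀ i, I.c i ≤ θ * B}ᶜ = {B : ℝ | ∃ i, θ * B < I.c i} := by
        ext B
        simp
      rw [this]
      exact ENNReal.toReal_le_of_le_ofReal hθ.le hI
    · obtain ⟨hB0, hB⟩ := hB
      have h1 := hP K I B hB0 fun i => (hBE i).trans
        (mul_le_mul_of_nonneg_right (min_le_left _ _) hB0.le)
      have h2 : (1 - 8 * d) * greedyRatio K I B ≤ rsgRatio K P I B := by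
        rw [greedyRatio, rsgRatio, mul_div_assoc']
        exact div_le_div_of_nonneg_right h1 (I.opt_pos hB0).le
      refine le_trans ?_ ((mul_le_mul_of_nonneg_left hB h8.le).trans h2)
      rw [mul_add]
      by_cases hBS : B ∈ S <;> simp [hBS]

end

end BudgetFeasible

theorem mainTheorem4 (D : MeasureTheory.Measure ℝ) [MeasureTheory.IsProbabilityMeasure D]
    (hpos : ∀ᵐ B ∂D, 0 < B) (hsupp : D.support.Nontrivial) :
    (∀ K : BudgetFeasible.Choices,
      ENNReal.ofReal (1 - 1 / Real.exp 1) <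
        BudgetFeasible.smoothedRatio D (BudgetFeasible.greedyRatio K) Set.univ) ∧
    (∃ (P : BudgetFeasible.RSGParams) (θ : ℝ), 0 < θ ∧ ∀ K : BudgetFeasible.Choices,
      ENNReal.ofReal (1 - 1 / Real.exp 1) <
        BudgetFeasible.smoothedRatio D (BudgetFeasible.rsgRatio K P)
          (BudgetFeasible.smallBidderMarkets D θ)) := by
  rw [one_div, ← Real.exp_neg]
  exact ⟨BudgetFeasible.lt_smoothedRatio_greedyRatio D hpos hsupp,
    BudgetFeasible.exists_lt_smoothedRatio_rsgRatio D hpos hsupp⟩
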